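/- **Notation.** Let $n\ge 2$ and let $\ell$ be a prime. Put $\mathbf Z_{(\ell)}=\mathbf Z[1/p,\ p\ne \ell]$, $\Gamma_\ell=\{A\in \mathbf{GL}_n(\mathbf Z_{(\ell)}) : \ell\mid A_{j1}\text{ for } j>1\}$ and $\pi_\ell=\mathrm{diag}(\ell,1,\dots,1)$. Let $\mathcal M$ be the set of real $n\times n$ matrices such that the entries of each column are linearly independent over $\mathbf Q$, and for $M\in\mathcal M$ put $f_M(x)=\prod_{j=1}^n (xM)_j$. *Cones.* Let $Q\in\mathbf R^n$ have components linearly independent over $\mathbf Q$. For $A=(A_1,\dots,A_n)\in \mathbf{GL}_n(\mathbf Q)^n$ let $\sigma_i$ be the first column of $A_i$, and define $\Phi_{\mathrm{Sh}}(A)(Q)\colon\mathbf R^n\to\mathbf Z$ to be $0$ if the $\sigma_i$ are linearly dependent, and otherwise $$\Phi_{\mathrm{Sh}}(A)(Q)(x)=\mathrm{sgn}\det(\sigma_1,\dots,\sigma_n)\,\lim_{\epsilon\to0^+}\mathbf 1_{C}(x+\epsilon Q),\qquad C=\mathbf R_{>0}\sigma_1+\dots+\mathbf R_{>0}\sigma_n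 .$$ *The pairing and the cocycle.* For a $\mathbf Z$-linear combination $\varphi$ of characteristic functions of rational open simplicial cones and $v\in\mathbf Q^n$, let $g(\varphi,v)\in\mathbf Q(x_1,\dots,x_n)$ be the rational function represented by the series $\sum_{m\in\mathbf Z^n}\varphi(v+m)x^m$ (that is, $g=q/p$ whenever $p\neq0$ and $q$ are Laurent polynomials with $p\cdot\sum_m\varphi(v+m)x^m=q$), and let $h(\varphi,v)(z)=e^{v\cdot z}g(\varphi,v)(e^{z_1},\dots,e^{z_n})$. It depends only on $\varphi$ and on $v$ modulo $\mathbf Z^n$. For $z=(z_1,\dots,z_n)$ put $$\Psi_{\mathrm{Sh}}(A,M,Q,v)=h(\Phi_{\mathrm{Sh}}(A)(Q),v)(zM^t),$$ $$\Psi_{\mathrm{Sh},\ell}(A,M,Q,v)=\Psi_{\mathrm{Sh}}(\pi_\ell A\pi_\ell^{-1},\pi_\ell^{-1}M,\pi_\ell Q,\pi_\ell v)-\ell\,\Psi_{\mathrm{Sh}}(A,M,Q,v),$$ elements of the fraction field $\mathbf R((z))$ of $\mathbf R[[z]]=\mathbf R[[z_1,\dots,z_n]]$. *The Shintani operator.*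 Let $\mathbf R((z))^{\mathrm{hd}}$ be the set of $G=g/p\in\mathbf R((z))$ with $g\in\mathbf R[[z]]$ and $p\in\mathbf R[z]$ homogeneous, of some degree $d$, such that the coefficient of $z_j^d$ in $p$ is nonzero for every $j$. For such $G$ put $Z_j=(z_jz_1,\dots,z_jz_{j-1},z_j,z_jz_{j+1},\dots,z_jz_n)$; then $G(Z_j)\in z_j^{-d}\mathbf R[[z]]$. For an integer $k\ge0$ define $$\Delta^{(k)}G=\frac{(k!)^n}{n}\sum_{j=1}^n \Big(\text{coefficient of } z_j^{nk}\prod_{i\ne j}z_i^k\text{ in }G(Z_j)\Big).$$ **Theorem 4.4.** Let $A\in\Gamma_\ell^n$, $M\in\mathcal M$, let $Q\in\mathbf R^n$ have components linearly independent over $\mathbf Q$, and let $v\in\mathbf Q^n$ (only its class in $\mathbf Q^n/\mathbf Z^n$ matters). Suppose that $$f_M\big(v+\tfrac1\ell\mathbf Z\oplus\mathbf Z^{n-1}\big)\subset\mathbf Z[\tfrac1\ell].$$ Then $\Psi_{\mathrm{Sh},\ell}(A,M,Q,v)$ lies in $\mathbf R((z))^{\mathrm{hd}}$, and for every integer $k\ge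 0$ $$\Delta^{(k)}\Psi_{\mathrm{Sh},\ell}(A,M,Q,v)\in\mathbf Z[\tfrac1\ell].$$ -/

import Mathlib

noncomputable section

namespace Shintani

open scoped Matrix Topology

/-! ## Cones and the perturbed characteristic functions -/

/-- The open cone `ℝ_{>0} w₁ + ⋯ + ℝ_{>0} w_r` in `ℝⁿ`. -/
def openCone {n r : ℕ} (w : Fin r → Fin n → ℝ) : Set (Fin n → ℝ) :=
  {x | ∃ t : Fin r → ℝ, (∀ i, 0 < t i) ∧ x = ∑ i, t i • w i}

open Classical in
/-- `c_Q(w₁, …, w_r)`, the function `x ↦ lim_{ε → 0⁺} 1_{C(w₁, …, w_r)}(x + ε Q)` if the `w_i` are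
linearly independent, and `0` otherwise.  (The limit of the `{0,1}`-valued function is `1` exactly
when the function is `1` for all small `ε > 0`.)  It is the characteristic function of the open
cone together with those of its faces that a small translation along `Q` moves into the cone. -/
def cQ {n r : ℕ} (Q : Fin n → ℝ) (w : Fin r → Fin n → ℝ) (x : Fin n → ℝ) : ℤ :=
  if LinearIndependent ℝ w ∧ ∀ᶠ ε in 𝓝[>] (0 : ℝ), x + ε • Q ∈ openCone w then 1 else 0

/-- The vectors of `ℝⁿ` whose components are linearly independent over `ℚ`. -/
def irrVec (n : ℕ) : Set (Fin n → ℝ) := {Q | LinearIndependent ℚ Q}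

/-- The real matrices such that the entries of each column are linearly independent over `ℚ`. -/
def irrMat (n : ℕ) : Set (Matrix (Fin n) (Fin n) ℝ) :=
  {M | ∀ j, LinearIndependent ℚ (fun i => M i j)}

/-- The matrix whose `i`-th column is the first column of `A i`. -/
def firstCols {n : ℕ} [NeZero n] (A : Fin n → GL (Fin n) ℚ) : Matrix (Fin n) (Fin n) ℚ :=
  Matrix.of fun r i => (A i : Matrix (Fin n) (Fin n) ℚ) r 0

/-- `Φ_Sh(A₁, …, A_n)(Q) = sgn(det(σ₁, …, σ_n)) c_Q(σ₁, …, σ_n)`, as a function on `ℝⁿ`, where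
`σ_i` is the first column of `A_i`. -/
def phiSh {n : ℕ} [NeZero n] (A : Fin n → GL (Fin n) ℚ) (Q : Fin n → ℝ) (x : Fin n → ℝ) : ℤ :=
  ((SignType.sign (firstCols A).det : SignType) : ℤ) *
    cQ Q (fun i r => ((firstCols A r i : ℚ) : ℝ)) x

/-! ## Generating functions of lattice points as rational functions -/

/-- Laurent polynomials over `ℚ` in `x₁, …, x_n`. -/
abbrev Laurent (n : ℕ) : Type := AddMonoidAlgebra ℚ (Fin n → ℤ)

/-- The field `ℚ(x₁, …, x_n)`. -/
abbrev RatFun (n : ℕ) : Type := FractionRing (Laurent n)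

/-- Multiplication by the monomial `x^d` on two-sided formal series `∑_m S(m) x^m`. -/
def shiftHom (n : ℕ) :
    Multiplicative (Fin n → ℤ) →* Module.End ℚ ((Fin n → ℤ) → ℚ) where
  toFun d :=
    { toFun := fun S m => S (m - d.toAdd)
      map_add' := fun _ _ => rfl
      map_smul' := fun _ _ => rfl }
  map_one' := by
    ext S m
    simp
  map_mul' d e := by
    refine LinearMap.ext fun S => funext fun m => ?_
    simp [sub_sub]

/-- The action of Laurent polynomials on two-sided formal series by multiplication. -/
def laurentAct (n : ℕ) : Laurent n →ₐ[ℚ] Module.End ℚ ((Fin n → ℤ) → ℚ) :=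
  AddMonoidAlgebra.lift ℚ _ _ (shiftHom n)

/-- A Laurent polynomial regarded as a formal series. -/
def laurentSeries {n : ℕ} (q : Laurent n) : (Fin n → ℤ) → ℚ := fun m => q.coeff m

/-- The formal series `∑_{m ∈ ℤⁿ} φ(v + m) x^m`; for the characteristic function `φ` of a cone `C`
this is the generating series of `(C - v) ∩ ℤⁿ`. -/
def genSeries {n : ℕ} (φ : (Fin n → ℝ) → ℤ) (v : Fin n → ℚ) : (Fin n → ℤ) → ℚ :=
  fun m => (φ (fun i => ((v i + m i : ℚ) : ℝ)) : ℚ)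

/-- `q / p` is the rational function of which the generating series of `φ` at `v` is the
expansion. -/
def IsGenFun {n : ℕ} (φ : (Fin n → ℝ) → ℤ) (v : Fin n → ℚ) (p q : Laurent n) : Prop :=
  p ≠ 0 ∧ laurentAct n p (genSeries φ v) = laurentSeries q

open Classical in
/-- `g(φ, v) ∈ ℚ(x)`: the rational function represented by the generating series
`∑_{m ∈ ℤⁿ} φ(v + m) x^m`.  It is additive in `φ`, it is `∑_a x^a / ∏ (1 - x^{σ_i})` (the sum over
the points of a half-open parallelepiped) for a rational open cone, and it vanishes for wedges,
whose series is annihilated by some `1 - x^m`, `m ≠ 0`. -/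
def coneGen {n : ℕ} (φ : (Fin n → ℝ) → ℤ) (v : Fin n → ℚ) : RatFun n :=
  if h : ∃ pq : Laurent n × Laurent n, IsGenFun φ v pq.1 pq.2 then
    algebraMap (Laurent n) (RatFun n) h.choose.2 / algebraMap (Laurent n) (RatFun n) h.choose.1
  else 0

/-! ## Exponential substitution -/

/-- The field of fractions of `ℝ⟦z₁, …, z_n⟧`. -/
abbrev FracPS (n : ℕ) : Type := FractionRing (MvPowerSeries (Fin n) ℝ)

/-- The power series `e^{c₁ z₁ + ⋯ + c_n z_n}`. -/
def linExp {n : ℕ} (c : Fin n → ℝ) : MvPowerSeries (Fin n) ℝ :=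
  fun r => ∏ j, c j ^ r j / (Nat.factorial (r j) : ℝ)

theorem linExp_zero (n : ℕ) : linExp (0 : Fin n → ℝ) = 1 := by
  classical
  ext r
  rw [MvPowerSeries.coeff_one]
  change ∏ j, (0 : Fin n → ℝ) j ^ r j / (Nat.factorial (r j) : ℝ) = _
  split_ifs with h
  · subst h
    simp
  · obtain ⟨j, hj⟩ : ∃ j, r j ≠ 0 := by
      by_contra hcon
      push Not at hcon
      exact h (Finsupp.ext hcon)
    exact Finset.prod_eq_zero (Finset.mem_univ j) (by simp [hj])

theorem linExp_add {n : ℕ} (c d : Fin n → ℝ) : linExp (c + d) = linExp c * linExp d := by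
  classical
  ext r
  rw [MvPowerSeries.coeff_mul]
  change ∏ j, (c + d) j ^ r j / (Nat.factorial (r j) : ℝ) =
    ∑ p ∈ Finset.HasAntidiagonal.antidiagonal r, (∏ j, c j ^ p.1 j / (Nat.factorial (p.1 j) : ℝ)) *
      ∏ j, d j ^ p.2 j / (Nat.factorial (p.2 j) : ℝ)
  have h1 : ∀ j, (c + d) j ^ r j / (Nat.factorial (r j) : ℝ) =
      ∑ p ∈ Finset.HasAntidiagonal.antidiagonal (r j), (c j ^ p.1 / (Nat.factorial p.1 : ℝ)) *
        (d j ^ p.2 / (Nat.factorial p.2 : ℝ)) := by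
    intro j
    rw [Pi.add_apply, (Commute.all (c j) (d j)).add_pow', Finset.sum_div]
    refine Finset.sum_congr rfl fun p hp => ?_
    rw [Finset.HasAntidiagonal.mem_antidiagonal] at hp
    rw [← hp, nsmul_eq_mul, Nat.cast_add_choose]
    have := Nat.cast_ne_zero (R := ℝ).2 (Nat.factorial_ne_zero p.1)
    have := Nat.cast_ne_zero (R := ℝ).2 (Nat.factorial_ne_zero p.2)
    have := Nat.cast_ne_zero (R := ℝ).2 (Nat.factorial_ne_zero (p.1 + p.2))
    field_simp
  rw [Finset.prod_congr rfl fun j _ => h1 j, Finset.prod_univ_sum]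
  symm
  refine Finset.sum_bij' (fun p _ => fun j => (p.1 j, p.2 j))
    (fun f _ => (Finsupp.equivFunOnFinite.symm fun j => (f j).1,
      Finsupp.equivFunOnFinite.symm fun j => (f j).2)) ?_ ?_ ?_ ?_ ?_
  · intro p hp
    rw [Finset.HasAntidiagonal.mem_antidiagonal] at hp
    simp [Fintype.mem_piFinset, ← hp]
  · intro f hf
    simp only [Fintype.mem_piFinset, Finset.HasAntidiagonal.mem_antidiagonal] at hf ⊢
    ext j
    simpa using hf j
  · intro p _
    ext <;> simp
  · intro f _
    ext <;> simp
  · intro p _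
    simp [Finset.prod_mul_distrib]

/-- The ring homomorphism `x^m ↦ e^{m · z Mᵗ}`, i.e. `x_i ↦ e^{(z Mᵗ)_i}`, from Laurent polynomials
to `ℝ⟦z⟧`; here `m · z Mᵗ = ∑_j (m M)_j z_j`. -/
def expEval {n : ℕ} (M : Matrix (Fin n) (Fin n) ℝ) :
    Laurent n →ₐ[ℚ] MvPowerSeries (Fin n) ℝ :=
  AddMonoidAlgebra.lift ℚ _ _
    { toFun := fun m => linExp ((fun i => ((m.toAdd i : ℤ) : ℝ)) ᵥ* M)
      map_one' := by
        have : (fun i : Fin n => (((Multiplicative.toAdd (1 : Multiplicative (Fin n → ℤ))) i : ℤ) : ℝ))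
            = 0 := by
          ext i
          simp
        rw [this, Matrix.zero_vecMul, linExp_zero]
      map_mul' := fun a b => by
        rw [← linExp_add, ← Matrix.add_vecMul]
        congr 2
        ext i
        simp }

/-- `q / p` represents `G` and its denominator survives the substitution `x_i ↦ e^{(z Mᵗ)_i}`. -/
def IsExpRep {n : ℕ} (M : Matrix (Fin n) (Fin n) ℝ) (G : RatFun n) (p q : Laurent n) : Prop :=
  expEval M p ≠ 0 ∧
    G * algebraMap (Laurent n) (RatFun n) p = algebraMap (Laurent n) (RatFun n) q

open Classical in
/-- `G(e^{(z Mᵗ)_1}, …, e^{(z Mᵗ)_n})` for a rational function `G`. -/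
def expSubst {n : ℕ} (M : Matrix (Fin n) (Fin n) ℝ) (G : RatFun n) : FracPS n :=
  if h : ∃ pq : Laurent n × Laurent n, IsExpRep M G pq.1 pq.2 then
    algebraMap _ (FracPS n) (expEval M h.choose.2) /
      algebraMap _ (FracPS n) (expEval M h.choose.1)
  else 0

/-- The Solomon–Hu pairing evaluated at `z Mᵗ`:
`h(φ, v)(z Mᵗ) = e^{v · z Mᵗ} g(φ, v)(e^{(z Mᵗ)_1}, …, e^{(z Mᵗ)_n})`. -/
def solomonHu {n : ℕ} (φ : (Fin n → ℝ) → ℤ) (v : Fin n → ℚ) (M : Matrix (Fin n) (Fin n) ℝ) :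
    FracPS n :=
  algebraMap _ (FracPS n) (linExp ((fun i => ((v i : ℚ) : ℝ)) ᵥ* M)) * expSubst M (coneGen φ v)

/-! ## The Shintani cocycle and its smoothing -/

/-- `Ψ_Sh(A, M, Q, v) = h(Φ_Sh(A)(Q), v)(z Mᵗ)`. -/
def psiSh {n : ℕ} [NeZero n] (A : Fin n → GL (Fin n) ℚ) (M : Matrix (Fin n) (Fin n) ℝ)
    (Q : Fin n → ℝ) (v : Fin n → ℚ) : FracPS n :=
  solomonHu (phiSh A Q) v M

/-- `π_ℓ = diag(ℓ, 1, …, 1)`. -/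
def piMat (n : ℕ) [NeZero n] (ℓ : ℕ) : Matrix (Fin n) (Fin n) ℚ :=
  Matrix.diagonal fun i => if i = 0 then (ℓ : ℚ) else 1

theorem piMat_det_ne_zero (n : ℕ) [NeZero n] (ℓ : ℕ) [Fact ℓ.Prime] : (piMat n ℓ).det ≠ 0 := by
  rw [piMat, Matrix.det_diagonal, Finset.prod_ne_zero_iff]
  intro i _
  split_ifs
  · exact_mod_cast (Fact.out : ℓ.Prime).ne_zero
  · exact one_ne_zero

/-- `π_ℓ` as an element of `GL_n(ℚ)`. -/
def piL (n : ℕ) [NeZero n] (ℓ : ℕ) [Fact ℓ.Prime] : GL (Fin n) ℚ :=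
  Matrix.GeneralLinearGroup.mkOfDetNeZero (piMat n ℓ) (piMat_det_ne_zero n ℓ)

/-- A rational matrix as a real matrix. -/
def toReal {n : ℕ} (B : Matrix (Fin n) (Fin n) ℚ) : Matrix (Fin n) (Fin n) ℝ :=
  B.map fun x => (x : ℝ)

/-- `Ψ_{Sh,ℓ}(A, M, Q, v)
  = Ψ_Sh(π_ℓ A π_ℓ⁻¹, π_ℓ⁻¹ M, π_ℓ Q, π_ℓ v) - ℓ Ψ_Sh(A, M, Q, v)`. -/
def psiShL {n : ℕ} [NeZero n] (ℓ : ℕ) [Fact ℓ.Prime] (A : Fin n → GL (Fin n) ℚ)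
    (M : Matrix (Fin n) (Fin n) ℝ) (Q : Fin n → ℝ) (v : Fin n → ℚ) : FracPS n :=
  psiSh (fun i => piL n ℓ * A i * (piL n ℓ)⁻¹)
      (toReal ((piL n ℓ)⁻¹ : GL (Fin n) ℚ).val * M)
      (toReal (piL n ℓ).val *ᵥ Q) ((piL n ℓ).val *ᵥ v)
    - (ℓ : FracPS n) * psiSh A M Q v

/-- Membership in `ℤ_(ℓ) = ℤ[1/p, p ≠ ℓ] ⊂ ℚ`. -/
def IsLocalInt (ℓ : ℕ) (x : ℚ) : Prop := ¬ ℓ ∣ x.den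

/-- `Γ_ℓ`: the matrices `A ∈ GL_n(ℤ_(ℓ))` with `ℓ ∣ A_{j1}` (in `ℤ_(ℓ)`) for all `j > 1`. -/
def gammaL (n : ℕ) [NeZero n] (ℓ : ℕ) : Set (GL (Fin n) ℚ) :=
  {A | (∀ i j, IsLocalInt ℓ (A.val i j)) ∧ (∀ i j, IsLocalInt ℓ ((A⁻¹).val i j)) ∧
    ∀ j, j ≠ 0 → ∃ y : ℚ, IsLocalInt ℓ y ∧ A.val j 0 = (ℓ : ℚ) * y}

/-! ## The Shintani operator -/

/-- `p` is homogeneous of degree `d` and all its power monomials `z_j^d` have nonzero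
coefficients. -/
def IsPowerful {n : ℕ} (p : MvPolynomial (Fin n) ℝ) (d : ℕ) : Prop :=
  p.IsHomogeneous d ∧ ∀ j, p.coeff (Finsupp.single j d) ≠ 0

/-- `ℝ((z))^hd`: the fractions `g / p` with `g` a power series and `p` a powerful polynomial. -/
def hd (n : ℕ) : Set (FracPS n) :=
  {G | ∃ (g : MvPowerSeries (Fin n) ℝ) (p : MvPolynomial (Fin n) ℝ) (d : ℕ), IsPowerful p d ∧
    G = algebraMap _ (FracPS n) g / algebraMap _ (FracPS n) (p : MvPowerSeries (Fin n) ℝ)}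

/-- `Z_j = (z_j z_1, …, z_j z_{j-1}, z_j, z_j z_{j+1}, …, z_j z_n)`. -/
def zVec {n : ℕ} (j : Fin n) : Fin n → MvPowerSeries (Fin n) ℝ :=
  fun i => if i = j then MvPowerSeries.X j else MvPowerSeries.X j * MvPowerSeries.X i

/-- `G(Z_j) = z_j^{-d} F`, where `G(Z_j) = g(Z_j) / p(Z_j)` for a presentation `G = g / p` with `p`
powerful. -/
def IsZExpansion {n : ℕ} (j : Fin n) (G : FracPS n) (d : ℕ) (F : MvPowerSeries (Fin n) ℝ) : Prop :=
  ∃ (g : MvPowerSeries (Fin n) ℝ) (p : MvPolynomial (Fin n) ℝ) (e : ℕ), IsPowerful p e ∧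
    G = algebraMap _ (FracPS n) g / algebraMap _ (FracPS n) (p : MvPowerSeries (Fin n) ℝ) ∧
    MvPowerSeries.X j ^ d * MvPowerSeries.subst (zVec j) g =
      F * MvPowerSeries.subst (zVec j) (p : MvPowerSeries (Fin n) ℝ)

/-- The exponent of the monomial `N(Z_j)^k = z_j^{nk} ∏_{i ≠ j} z_i^k`. -/
def zExp {n : ℕ} (k : ℕ) (j : Fin n) : Fin n →₀ ℕ :=
  Finsupp.equivFunOnFinite.symm fun i => if i = j then n * k else k

open Classical in
/-- `Δ_j^{(k)} G`, the coefficient of `N(Z_j)^k` in `G(Z_j) ∈ z_j^{-d} ℝ⟦z⟧`, for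
`G ∈ ℝ((z))^hd`. -/
def deltaJ {n : ℕ} (k : ℕ) (j : Fin n) (G : FracPS n) : ℝ :=
  if h : ∃ dF : ℕ × MvPowerSeries (Fin n) ℝ, IsZExpansion j G dF.1 dF.2 then
    MvPowerSeries.coeff (zExp k j + Finsupp.single j h.choose.1) h.choose.2
  else 0

/-- The Shintani operator `Δ^{(k)} = ((k!)^n / n) ∑_j Δ_j^{(k)}`. -/
def shintaniOp {n : ℕ} (k : ℕ) (G : FracPS n) : ℝ :=
  ((Nat.factorial k : ℝ) ^ n / n) * ∑ j, deltaJ k j G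

/-! ## The integrality condition -/

/-- `f_M(x) = N(x M) = (x M)_1 ⋯ (x M)_n`. -/
def normForm {n : ℕ} (M : Matrix (Fin n) (Fin n) ℝ) (x : Fin n → ℝ) : ℝ := ∏ j, (x ᵥ* M) j

/-- `ℤ[1/ℓ] ⊂ ℝ`. -/
def zInv (ℓ : ℕ) : Subalgebra ℤ ℝ := Algebra.adjoin ℤ {((ℓ : ℝ))⁻¹}

/-- The lattice `(1/ℓ) ℤ ⊕ ℤ^{n-1}`. -/
def latticeL (n : ℕ) [NeZero n] (ℓ : ℕ) : Set (Fin n → ℚ) :=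
  {x | (∃ a : ℤ, x 0 = (a : ℚ) / ℓ) ∧ ∀ i, i ≠ 0 → ∃ a : ℤ, x i = (a : ℚ)}

/-! ## Independence of choices -/

theorem laurentAct_series {n : ℕ} (p q : Laurent n) :
    laurentAct n p (laurentSeries q) = laurentSeries (p * q) := by
  induction p using AddMonoidAlgebra.induction_linear with
  | zero =>
    ext m
    simp [laurentSeries]
  | add f g hf hg =>
    rw [map_add, LinearMap.add_apply, hf, hg, add_mul]
    ext m
    simp [laurentSeries]
  | single d c =>
    ext m
    simp only [laurentAct, AddMonoidAlgebra.lift_single, LinearMap.smul_apply, Pi.smul_apply,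
      laurentSeries, smul_eq_mul]
    rw [AddMonoidAlgebra.coeff_single_mul_eq_mul_coeff (m - d)
      (fun m' _ => by rw [eq_sub_iff_add_eq, add_comm])]
    rfl

theorem coneGen_eq {n : ℕ} {φ : (Fin n → ℝ) → ℤ} {v : Fin n → ℚ} {p q : Laurent n}
    (h : IsGenFun φ v p q) :
    coneGen φ v = algebraMap (Laurent n) (RatFun n) q / algebraMap (Laurent n) (RatFun n) p := by
  have hex : ∃ pq : Laurent n × Laurent n, IsGenFun φ v pq.1 pq.2 := ⟨(p, q), h⟩
  rw [coneGen, dif_pos hex]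
  obtain ⟨h0, h1⟩ := hex.choose_spec
  obtain ⟨h2, h3⟩ := h
  generalize hex.choose.1 = p' at *
  generalize hex.choose.2 = q' at *
  have key : p * q' = p' * q := by
    have e : laurentSeries (p * q') = laurentSeries (p' * q) := by
      rw [← laurentAct_series, ← laurentAct_series, ← h1, ← h3, ← Module.End.mul_apply,
        ← Module.End.mul_apply, ← map_mul, ← map_mul, mul_comm]
    exact AddMonoidAlgebra.ext (Finsupp.ext fun m => congrFun e m)
  have inj := FaithfulSMul.algebraMap_injective (Laurent n) (RatFun n)
  rw [div_eq_div_iff ((map_ne_zero_iff _ inj).2 h0) ((map_ne_zero_iff _ inj).2 h2), ← map_mul,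
    ← map_mul, mul_comm q' p, mul_comm q p', key]

theorem expSubst_eq {n : ℕ} {M : Matrix (Fin n) (Fin n) ℝ} {G : RatFun n} {p q : Laurent n}
    (h : IsExpRep M G p q) :
    expSubst M G = algebraMap _ (FracPS n) (expEval M q) / algebraMap _ (FracPS n) (expEval M p) := by
  have hex : ∃ pq : Laurent n × Laurent n, IsExpRep M G pq.1 pq.2 := ⟨(p, q), h⟩
  rw [expSubst, dif_pos hex]
  obtain ⟨h0, h1⟩ := hex.choose_spec
  obtain ⟨h2, h3⟩ := h
  generalize hex.choose.1 = p' at *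
  generalize hex.choose.2 = q' at *
  have inj := FaithfulSMul.algebraMap_injective (Laurent n) (RatFun n)
  have inj' := FaithfulSMul.algebraMap_injective (MvPowerSeries (Fin n) ℝ) (FracPS n)
  have key : q' * p = q * p' := by
    apply inj
    rw [map_mul, map_mul, ← h1, ← h3]
    ring
  rw [div_eq_div_iff ((map_ne_zero_iff _ inj').2 h0) ((map_ne_zero_iff _ inj').2 h2), ← map_mul,
    ← map_mul, ← map_mul, ← map_mul, key]

theorem hasSubst_zVec {n : ℕ} (j : Fin n) : MvPowerSeries.HasSubst (zVec j) := by
  refine MvPowerSeries.hasSubst_of_constantCoeff_zero fun i => ?_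
  unfold zVec
  split_ifs <;> simp

theorem subst_zVec_ne_zero {n : ℕ} (j : Fin n) {p : MvPolynomial (Fin n) ℝ} {e : ℕ}
    (hp : IsPowerful p e) :
    MvPowerSeries.subst (zVec j) (p : MvPowerSeries (Fin n) ℝ) ≠ 0 := by
  classical
  let y : Fin n → MvPolynomial (Fin n) ℝ := fun i =>
    if i = j then MvPolynomial.X j else MvPolynomial.X j * MvPolynomial.X i
  have hy : zVec j = fun i => MvPolynomial.coeToMvPowerSeries.algHom ℝ (y i) := by
    funext i
    by_cases h : i = j <;> simp [zVec, y, h]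
  have h1 : MvPowerSeries.subst (zVec j) (p : MvPowerSeries (Fin n) ℝ) =
      ((MvPolynomial.aeval y p : MvPolynomial (Fin n) ℝ) : MvPowerSeries (Fin n) ℝ) := by
    rw [MvPowerSeries.subst_coe, hy]
    have := MvPolynomial.comp_aeval_apply (φ := MvPolynomial.coeToMvPowerSeries.algHom
      (σ := Fin n) (R := ℝ) ℝ) (f := y) p
    rw [← this]
    simp
  rw [h1]
  intro h0
  have h2 : MvPolynomial.aeval y p = 0 := by
    exact_mod_cast h0
  have h3 : MvPolynomial.eval (Pi.single j (1 : ℝ)) p = 0 := by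
    have h4 := congrArg (MvPolynomial.aeval (Pi.single j (1 : ℝ) : Fin n → ℝ)) h2
    rw [MvPolynomial.comp_aeval_apply, map_zero] at h4
    have h5 : (fun i => MvPolynomial.aeval (Pi.single j (1 : ℝ) : Fin n → ℝ) (y i)) =
        (Pi.single j (1 : ℝ) : Fin n → ℝ) := by
      funext i
      by_cases h : i = j
      · subst h
        simp [y]
      · simp [y, h]
    rw [h5] at h4
    rw [← MvPolynomial.coe_aeval_eq_eval]
    exact h4
  apply hp.2 j
  rw [MvPolynomial.eval_eq'] at h3
  rw [← h3]
  rw [Finset.sum_eq_single (Finsupp.single j e)]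
  · rw [Finset.prod_eq_one, mul_one]
    intro i _
    by_cases h : i = j
    · subst h
      simp
    · simp [h]
  · intro d hd hne
    obtain ⟨i, hij, hi⟩ : ∃ i, i ≠ j ∧ d i ≠ 0 := by
      by_contra hcon
      push Not at hcon
      have hs : d = Finsupp.single j (d j) := by
        ext i
        by_cases h : i = j
        · subst h
          simp
        · simp [Ne.symm h, hcon i h]
      have hdeg : d.degree = e := by
        by_contra hcon2
        exact (MvPolynomial.mem_support_iff.1 hd) (hp.1.coeff_eq_zero hcon2)
      rw [hs, Finsupp.degree_single] at hdeg
      exact hne (by rw [hs, hdeg])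
    rw [Finset.prod_eq_zero (Finset.mem_univ i), mul_zero]
    simp [hij, hi]
  · intro hns
    rw [MvPolynomial.notMem_support_iff.1 hns, zero_mul]

theorem IsZExpansion.coeff_eq {n : ℕ} {j : Fin n} {G : FracPS n} {d d' : ℕ}
    {F F' : MvPowerSeries (Fin n) ℝ} (h : IsZExpansion j G d F) (h' : IsZExpansion j G d' F')
    (s : Fin n →₀ ℕ) :
    MvPowerSeries.coeff (s + Finsupp.single j d) F =
      MvPowerSeries.coeff (s + Finsupp.single j d') F' := by
  obtain ⟨g, p, e, hp, hG, hF⟩ := h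
  obtain ⟨g', p', e', hp', hG', hF'⟩ := h'
  have inj := FaithfulSMul.algebraMap_injective (MvPowerSeries (Fin n) ℝ) (FracPS n)
  have nz := subst_zVec_ne_zero j hp
  have nz' := subst_zVec_ne_zero j hp'
  have ne : ∀ {q : MvPowerSeries (Fin n) ℝ}, MvPowerSeries.subst (zVec j) q ≠ 0 → q ≠ 0 := by
    rintro q hq rfl
    apply hq
    rw [← MvPowerSeries.coe_substAlgHom (hasSubst_zVec j), map_zero]
  have key : g * (p' : MvPowerSeries (Fin n) ℝ) = g' * (p : MvPowerSeries (Fin n) ℝ) := by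
    have h1 := hG.symm.trans hG'
    rw [div_eq_div_iff ((map_ne_zero_iff _ inj).2 (ne nz)) ((map_ne_zero_iff _ inj).2 (ne nz')),
      ← map_mul, ← map_mul] at h1
    exact inj h1
  have key2 := congrArg (MvPowerSeries.subst (zVec j)) key
  rw [MvPowerSeries.subst_mul (hasSubst_zVec j), MvPowerSeries.subst_mul (hasSubst_zVec j)] at key2
  have key3 : MvPowerSeries.X j ^ d' * F = MvPowerSeries.X j ^ d * F' := by
    apply mul_right_cancel₀ (mul_ne_zero nz nz')
    linear_combination (-(MvPowerSeries.X j ^ d' *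
      MvPowerSeries.subst (zVec j) (p' : MvPowerSeries (Fin n) ℝ))) * hF +
      (MvPowerSeries.X j ^ d * MvPowerSeries.subst (zVec j) (p : MvPowerSeries (Fin n) ℝ)) * hF' +
      (MvPowerSeries.X j ^ d' * MvPowerSeries.X j ^ d) * key2
  have key4 := congrArg (MvPowerSeries.coeff
    (Finsupp.single j d' + (s + Finsupp.single j d))) key3
  rw [MvPowerSeries.X_pow_eq, MvPowerSeries.X_pow_eq, MvPowerSeries.coeff_add_monomial_mul,
    show Finsupp.single j d' + (s + Finsupp.single j d) =
      Finsupp.single j d + (s + Finsupp.single j d') by abel,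
    MvPowerSeries.coeff_add_monomial_mul] at key4
  simpa using key4

theorem deltaJ_eq {n : ℕ} (k : ℕ) {j : Fin n} {G : FracPS n} {d : ℕ}
    {F : MvPowerSeries (Fin n) ℝ} (h : IsZExpansion j G d F) :
    deltaJ k j G = MvPowerSeries.coeff (zExp k j + Finsupp.single j d) F := by
  have hex : ∃ dF : ℕ × MvPowerSeries (Fin n) ℝ, IsZExpansion j G dF.1 dF.2 := ⟨(d, F), h⟩
  rw [deltaJ, dif_pos hex]
  exact hex.choose_spec.coeff_eq h _

end Shintani

end

namespace Shintani

open scoped Matrix Topology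

/-! ## Half-open cones in coordinates -/

/-! Conjugation by π_ℓ turns the generators σ_i into ℓ⁻¹π_ℓσ_i. The conditions defining Γ_ℓ make
these vectors ℓ-integral with an ℓ-unit at index 0, so each has a positive multiple ρ_i ∈ ℤⁿ whose
entry at index 0 is 1 mod ℓ (`exists_generator`). Transported by π_ℓ, the unconjugated term becomes
the conjugated lattice-point series restricted to the points m with ℓ ∣ m_0 (`phiSh_piL_conj`). The
smoothed cocycle is therefore the series of one half-open cone with the weight u = 1 - ℓ·1[ℓ ∣ m_0].
Over ℓ consecutive points in direction ρ_i the weights sum to ℓ - ℓ = 0. Multiplying by 1 + y_i + ⋯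
+ y_i^{ℓ-1}, y_i = x^{ρ_i}, for all i thus leaves finitely many terms
(`exists_laurent_weighted_cone`), and the cocycle equals e^{v·zMᵗ} V/B after exponential
substitution, with V integral and B the product of these polynomials (`psiShL_mul_eq`).

Since B takes the value ℓⁿ at x = 1, there is no pole at z = 0: the cocycle is a power series, and
on power series the Shintani operator is (k!)ⁿ times the coefficient of (z_1⋯z_n)^k. On e^{c·z} this
gives (c_1⋯c_n)^k. Expanding 1/B geometrically in 1 - ℓ⁻ⁿB, where high powers do not reach the
coefficient, leaves a ℤ[1/ℓ]-combination of exponentials (`factorial_pow_mul_coeff_mem`). Their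
contributions are k-th powers of values of f_M on v + (1/ℓ)ℤ ⊕ ℤ^{n-1}, which are ℓ-integral by
hypothesis. -/

theorem cQ_eq_prod {n : ℕ} (Q : Fin n → ℝ) {w : Fin n → Fin n → ℝ} (hw : LinearIndependent ℝ w) :
    ∃ (t : (Fin n → ℝ) ≃ₗ[ℝ] (Fin n → ℝ)) (κ : Fin n → ℝ → ℤ),
      (∀ i x, x < 0 → κ i x = 0) ∧ (∀ i x, 0 < x → κ i x = 1) ∧
      (∀ i, t (w i) = Pi.single i 1) ∧ ∀ x, cQ Q w x = ∏ i, κ i (t x i) := by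
  classical
  let b := basisOfLinearIndependentOfCardEqFinrank' w hw (by simp)
  have hb : ∀ i, b i = w i := fun i => by simp [b]
  let t := b.equivFun
  have htw : ∀ i, t (w i) = Pi.single i 1 := fun i => by
    rw [← hb]
    ext j
    simp [t, Pi.single_apply, eq_comm]
  have hcone : ∀ x, x ∈ openCone w ↔ ∀ i, 0 < t x i := by
    intro x
    constructor
    · rintro ⟨s, hs, rfl⟩ i
      have : t (∑ i, s i • w i) = s := by
        ext j
        simp [map_sum, htw, Pi.single_apply]
      rw [this]
      exact hs i
    · intro h
      refine ⟨t x, h, ?_⟩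
      conv_lhs => rw [← b.sum_equivFun x]
      exact Finset.sum_congr rfl fun i _ => by rw [hb]
  -- A small perturbation does not change the sign of a nonzero coordinate; only the value of κ at 0
  -- depends on Q.
  have hev : ∀ {i} {x : ℝ}, x ≠ 0 → ∀ᶠ ε in 𝓝[>] (0 : ℝ), (0 < x + ε * t Q i ↔ 0 < x) := by
    intro i x hx
    have hlim : Filter.Tendsto (fun ε : ℝ => x + ε * t Q i) (𝓝[>] 0) (𝓝 x) := by
      have : Continuous (fun ε : ℝ => x + ε * t Q i) := by fun_prop
      have h2 := this.tendsto 0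
      simp only [zero_mul, add_zero] at h2
      exact h2.mono_left nhdsWithin_le_nhds
    rcases lt_or_gt_of_ne hx with h | h
    · filter_upwards [hlim.eventually (gt_mem_nhds h)] with ε hε
      constructor <;> intro <;> linarith
    · filter_upwards [hlim.eventually (lt_mem_nhds h)] with ε hε
      exact ⟨fun _ => h, fun _ => hε⟩
  refine ⟨t, fun i x => if ∀ᶠ ε in 𝓝[>] (0 : ℝ), 0 < x + ε * t Q i then 1 else 0, ?_, ?_, htw, ?_⟩
  · intro i x hx
    refine if_neg fun h => ?_
    obtain ⟨ε, h1, h2⟩ := (h.and (hev (i := i) hx.ne)).exists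
    exact absurd (h2.1 h1) (by linarith)
  · intro i x hx
    refine if_pos ?_
    filter_upwards [hev (i := i) hx.ne'] with ε h
    exact h.2 hx
  · intro x
    rw [Finset.prod_ite_zero, cQ]
    simp [hw, hcone, Filter.eventually_all]

theorem cQ_of_not_linearIndependent {n r : ℕ} (Q : Fin n → ℝ) {w : Fin r → Fin n → ℝ}
    (hw : ¬ LinearIndependent ℝ w) (x : Fin n → ℝ) : cQ Q w x = 0 := by
  rw [cQ, if_neg fun h => hw h.1]

/-! ## Multiplication of formal series by Laurent polynomials -/

theorem laurentAct_single {n : ℕ} (d : Fin n → ℤ) (c : ℚ) (S : (Fin n → ℤ) → ℚ) (m : Fin n → ℤ) :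
    laurentAct n (AddMonoidAlgebra.single d c) S m = c * S (m - d) := by
  simp [laurentAct, AddMonoidAlgebra.lift_single, shiftHom]

theorem laurentAct_sum {n : ℕ} {ι : Type*} (s : Finset ι) (f : ι → Laurent n)
    (S : (Fin n → ℤ) → ℚ) (m : Fin n → ℤ) :
    laurentAct n (∑ j ∈ s, f j) S m = ∑ j ∈ s, laurentAct n (f j) S m := by
  rw [map_sum, LinearMap.sum_apply, Finset.sum_apply]

theorem laurentAct_mul {n : ℕ} (p q : Laurent n) (S : (Fin n → ℤ) → ℚ) :
    laurentAct n (p * q) S = laurentAct n p (laurentAct n q S) := by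
  rw [map_mul, Module.End.mul_apply]

theorem laurentSeries_injective (n : ℕ) :
    Function.Injective (laurentSeries : Laurent n → (Fin n → ℤ) → ℚ) := fun _ _ h =>
  AddMonoidAlgebra.ext (Finsupp.ext fun m => congrFun h m)

theorem exists_laurentSeries_eq {n : ℕ} {S : (Fin n → ℤ) → ℚ} (hS : {m | S m ≠ 0}.Finite) :
    ∃ q : Laurent n, laurentSeries q = S :=
  ⟨.ofCoeff (Finsupp.onFinset hS.toFinset S fun m hm => by simpa using hm), rfl⟩

/-- The polynomial `∑_{j < N} a_j y^j` in the monomial `y = x^ρ`. -/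
noncomputable def monoPoly {n : ℕ} (N : ℕ) (a : ℕ → ℚ) (ρ : Fin n → ℤ) : Laurent n :=
  ∑ j ∈ Finset.range N, AddMonoidAlgebra.single (j • ρ) (a j)

theorem laurentAct_monoPoly {n : ℕ} (N : ℕ) (a : ℕ → ℚ) (ρ : Fin n → ℤ) (S : (Fin n → ℤ) → ℚ)
    (m : Fin n → ℤ) :
    laurentAct n (monoPoly N a ρ) S m = ∑ j ∈ Finset.range N, a j * S (m - j • ρ) := by
  rw [monoPoly, laurentAct_sum]
  exact Finset.sum_congr rfl fun j _ => laurentAct_single _ _ _ _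

/-- Transfers to a product any property of series, such as integrality or vanishing on a region,
that each factor preserves. -/
theorem laurentAct_prod_induction {n : ℕ} {ι : Type*} (P : ((Fin n → ℤ) → ℚ) → Prop)
    (s : Finset ι) (f : ι → Laurent n) (h : ∀ i ∈ s, ∀ S, P S → P (laurentAct n (f i) S))
    {S : (Fin n → ℤ) → ℚ} (hS : P S) : P (laurentAct n (∏ i ∈ s, f i) S) := by
  classical
  induction s using Finset.induction_on with
  | empty => simpa using hS
  | insert i s hi ih =>
    rw [Finset.prod_insert hi, laurentAct_mul]
    exact h i (Finset.mem_insert_self i s) _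
      (ih fun j hj => h j (Finset.mem_insert_of_mem hj))

theorem laurentAct_prod_monoPoly_int {n : ℕ} {N : ℕ} {a : ℕ → ℚ}
    (ha : ∀ j, a j ∈ Set.range ((↑) : ℤ → ℚ)) (ρ : Fin n → Fin n → ℤ) {S : (Fin n → ℤ) → ℚ}
    (hS : ∀ m, S m ∈ Set.range ((↑) : ℤ → ℚ)) (m : Fin n → ℤ) :
    laurentAct n (∏ i, monoPoly N a (ρ i)) S m ∈ Set.range ((↑) : ℤ → ℚ) := by
  refine laurentAct_prod_induction (fun S => ∀ m, S m ∈ Set.range ((↑) : ℤ → ℚ)) _ _ ?_ hS m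
  intro i _ S hS m
  rw [laurentAct_monoPoly]
  exact sum_mem (S := (Int.castRingHom ℚ).range) fun j _ =>
    mul_mem (show a j ∈ (Int.castRingHom ℚ).range from ha j)
      (show S _ ∈ (Int.castRingHom ℚ).range from hS _)

/-! ## Weighted generating series of cones -/

theorem finite_lattice_points {n : ℕ} (t : (Fin n → ℝ) ≃ₗ[ℝ] (Fin n → ℝ)) (v : Fin n → ℝ)
    (c : Fin n → ℝ) :
    {m : Fin n → ℤ | ∀ i, 0 ≤ t (fun j => v j + m j) i ∧ t (fun j => v j + m j) i ≤ c i}.Finite := by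
  have hcpt : IsCompact (t.symm '' Set.Icc 0 c) :=
    isCompact_Icc.image t.symm.toContinuousLinearEquiv.continuous
  obtain ⟨l, hl⟩ := hcpt.isBounded.bddBelow
  obtain ⟨r, hr⟩ := hcpt.isBounded.bddAbove
  refine (Set.finite_Icc (fun i => ⌊l i - v i⌋) (fun i => ⌈r i - v i⌉)).subset ?_
  intro m hm
  have hmem : (fun j => v j + m j) ∈ t.symm '' Set.Icc 0 c :=
    ⟨t (fun j => v j + m j), ⟨fun i => (hm i).1, fun i => (hm i).2⟩, by simp⟩
  constructor
  · intro i
    have h1 := hl hmem i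
    have h2 := Int.floor_le (l i - v i)
    simp only at h1
    exact_mod_cast (by linarith : ((⌊l i - v i⌋ : ℤ) : ℝ) ≤ m i)
  · intro i
    have h1 := hr hmem i
    have h2 := Int.le_ceil (r i - v i)
    simp only at h1
    exact_mod_cast (by linarith : (m i : ℝ) ≤ ((⌈r i - v i⌉ : ℤ) : ℝ))

/-- The weighted generating series of a half-open cone becomes a Laurent polynomial after
multiplication by polynomials in the generators that annihilate the weight. -/
theorem exists_laurent_weighted_cone {n ℓ N : ℕ} [NeZero n] (Q : Fin n → ℝ)
    (w : Fin n → Fin n → ℝ) (c : Fin n → ℝ) (hc : ∀ i, 0 < c i) (ρ : Fin n → Fin n → ℤ)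
    (hρ : ∀ i j, (ρ i j : ℝ) = c i * w i j) (hρ0 : ∀ i, (ρ i 0 : ZMod ℓ) = 1)
    (s : ℤ) (v : Fin n → ℝ) (u : ZMod ℓ → ℚ) (a : ℕ → ℚ)
    (hau : ∀ b : ZMod ℓ, ∑ j ∈ Finset.range N, a j * u (b - j) = 0) :
    ∃ q : Laurent n, laurentSeries q = laurentAct n (∏ i, monoPoly N a (ρ i))
      (fun m => u (m 0) * ((s * cQ Q w (fun j => v j + m j) : ℤ) : ℚ)) := by
  classical
  by_cases hw : LinearIndependent ℝ w
  swap
  -- For dependent generators the series itself vanishes.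
  · refine ⟨0, ?_⟩
    have : (fun m : Fin n → ℤ => u (m 0) * ((s * cQ Q w (fun j => v j + m j) : ℤ) : ℚ)) = 0 := by
      ext m
      simp [cQ_of_not_linearIndependent Q hw]
    rw [this, map_zero]
    rfl
  obtain ⟨t, κ, hneg, hpos, htw, hcQ⟩ := cQ_eq_prod Q hw
  have htρ : ∀ (i : Fin n) (j : ℕ) (m : Fin n → ℤ) (i' : Fin n),
      t (fun k => v k + (m - j • ρ i) k) i' =
        t (fun k => v k + m k) i' - (if i' = i then j * c i else 0) := by
    intro i j m i'
    have : (fun k => v k + (((m - j • ρ i) k : ℤ) : ℝ)) =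
        (fun k => v k + (m k : ℝ)) - ((j : ℝ) * c i) • w i := by
      ext k
      simp [hρ]
      ring
    rw [this, map_sub, map_smul, htw]
    simp [Pi.single_apply]
  -- The product is supported in the box 0 ≤ t_i ≤ N c_i, which contains finitely many lattice
  -- points.
  refine exists_laurentSeries_eq ((finite_lattice_points t v fun i => N * c i).subset ?_)
  intro m hm i
  by_contra hcon
  rw [not_and_or, not_le, not_le] at hcon
  apply hm
  -- The factor in direction i acts first and creates the vanishing outside the slab 0 ≤ t_i ≤ N
  -- c_i. The remaining factors translate along ρ_{i'} with i' ≠ i, which fixes t_i, so they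
  -- preserve it.
  rw [← Finset.prod_erase_mul _ _ (Finset.mem_univ i), laurentAct_mul]
  refine laurentAct_prod_induction (fun S => ∀ m : Fin n → ℤ, (t (fun j => v j + m j) i < 0 ∨
    N * c i < t (fun j => v j + m j) i) → S m = 0) _ _ ?_ ?_ m hcon
  · intro i' hi' S hS m hm
    rw [laurentAct_monoPoly]
    refine Finset.sum_eq_zero fun j _ => ?_
    rw [hS, mul_zero]
    rw [htρ, if_neg (Finset.ne_of_mem_erase hi').symm, sub_zero]
    exact hm
  · intro m hm
    rw [laurentAct_monoPoly]
    -- Translation by jρ_i lowers t_i by j c_i and m_0 by j mod ℓ; all other factors of the cone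
    -- function are constant in j.
    have hfac : ∀ j ∈ Finset.range N,
        a j * (u (((m - j • ρ i) 0 : ℤ) : ZMod ℓ) *
          ((s * cQ Q w (fun k => v k + (m - j • ρ i) k) : ℤ) : ℚ)) =
        (a j * u ((m 0 : ZMod ℓ) - j)) * (κ i (t (fun k => v k + m k) i - j * c i) *
          (s * ∏ i' ∈ Finset.univ.erase i, κ i' (t (fun k => v k + m k) i') : ℤ)) := by
      intro j _
      rw [hcQ, ← Finset.mul_prod_erase _ _ (Finset.mem_univ i), htρ, if_pos rfl]
      rw [Finset.prod_congr rfl fun i' hi' => by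
        rw [htρ, if_neg (Finset.ne_of_mem_erase hi'), sub_zero]]
      simp [hρ0]
      ring
    rw [Finset.sum_congr rfl hfac]
    -- Below the slab every translate lies outside the cone. Above it κ_i is 1 for all j < N, so
    -- only the sum of the weights is left, which is zero by `hau`.
    rcases hm with hm | hm
    · refine Finset.sum_eq_zero fun j _ => ?_
      rw [hneg]
      · simp
      · have := mul_nonneg (Nat.cast_nonneg (α := ℝ) j) (hc i).le
        linarith
    · rw [Finset.sum_congr rfl fun j hj => by
        rw [hpos i _ (by
          have : (j : ℝ) * c i ≤ N * c i := by
            have := (Finset.mem_range.1 hj).le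
            have := (hc i).le
            gcongr
          linarith)]]
      rw [← Finset.sum_mul, hau, zero_mul]

/-! ## The Shintani operator on power series -/

/-- The exponent `(k, …, k)`. -/
noncomputable def diagExp (n k : ℕ) : Fin n →₀ ℕ := Finsupp.equivFunOnFinite.symm fun _ => k

/-- Under z ↦ Z_j the monomial z^d becomes z_j^{|d|} ∏_{i≠j} z_i^{d_i}. Distinct d give distinct
monomials, and (k, …, k) is the exponent mapped to `zExp k j`. -/
theorem coeff_subst_zVec {n : ℕ} (k : ℕ) (j : Fin n) (F : MvPowerSeries (Fin n) ℝ) :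
    MvPowerSeries.coeff (zExp k j) (MvPowerSeries.subst (zVec j) F) =
      MvPowerSeries.coeff (diagExp n k) F := by
  classical
  have hmon : ∀ d : Fin n →₀ ℕ, (d.prod fun i e => zVec (n := n) j i ^ e) =
      MvPowerSeries.monomial (Finsupp.equivFunOnFinite.symm
        fun i => if i = j then ∑ i, d i else d i) (1 : ℝ) := by
    intro d
    have hz : ∀ i, zVec (n := n) j i = MvPowerSeries.monomial
        (if i = j then Finsupp.single j 1 else Finsupp.single j 1 + Finsupp.single i 1) (1 : ℝ) := by
      intro i
      unfold zVec
      split_ifs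
      · rfl
      · rw [MvPowerSeries.X, MvPowerSeries.X, MvPowerSeries.monomial_mul_monomial, one_mul]
    rw [Finsupp.prod_fintype _ _ (by simp)]
    simp only [hz, MvPowerSeries.monomial_pow, one_pow]
    rw [MvPowerSeries.prod_monomial]
    congr 1
    · congr 1
      ext i
      rw [Finsupp.finsetSum_apply]
      by_cases hi : i = j
      · subst hi
        simp only [Finsupp.equivFunOnFinite_symm_apply_apply, if_true]
        refine Finset.sum_congr rfl fun x _ => ?_
        by_cases hx : x = i <;> simp [hx]
      · simp only [Finsupp.equivFunOnFinite_symm_apply_apply, if_neg hi]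
        rw [Finset.sum_eq_single i]
        · simp [hi]
        · intro x _ hx
          by_cases hxj : x = j
          · simp [hxj, Ne.symm hi]
          · simp [hxj, Ne.symm hi, hx]
        · simp
    · simp
  rw [MvPowerSeries.coeff_subst (hasSubst_zVec j), finsum_eq_single _ (diagExp n k)]
  · rw [hmon, MvPowerSeries.coeff_monomial, if_pos]
    · simp
    · ext i
      simp [zExp, diagExp]
  · intro d hd
    rw [hmon, MvPowerSeries.coeff_monomial, if_neg, smul_zero]
    intro h
    apply hd
    have h1 : ∀ i, i ≠ j → d i = k := by
      intro i hi
      have := DFunLike.congr_fun h i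
      simp only [zExp, Finsupp.equivFunOnFinite_symm_apply_apply, if_neg hi] at this
      exact this.symm
    have h2 : ∑ i, d i = n * k := by
      have := DFunLike.congr_fun h j
      simpa [zExp, eq_comm] using this
    have h3 : d j = k := by
      rw [← Finset.add_sum_erase _ _ (Finset.mem_univ j),
        Finset.sum_congr rfl fun i hi => h1 i (Finset.ne_of_mem_erase hi), Finset.sum_const,
        Finset.card_erase_of_mem (Finset.mem_univ j), Finset.card_univ, Fintype.card_fin,
        smul_eq_mul] at h2
      obtain ⟨m, rfl⟩ := Nat.exists_eq_succ_of_ne_zero (Nat.ne_of_gt j.pos)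
      rw [Nat.succ_sub_one, Nat.succ_mul] at h2
      omega
    ext i
    by_cases hi : i = j
    · subst hi
      simp [diagExp, h3]
    · simp [diagExp, h1 i hi]

theorem isPowerful_one (n : ℕ) : IsPowerful (1 : MvPolynomial (Fin n) ℝ) 0 :=
  ⟨MvPolynomial.isHomogeneous_one _ _, fun j => by simp⟩

theorem algebraMap_mem_hd {n : ℕ} (F : MvPowerSeries (Fin n) ℝ) :
    algebraMap _ (FracPS n) F ∈ hd n :=
  ⟨F, 1, 0, isPowerful_one n, by simp⟩

/-- With denominator 1 all n summands coincide, and the factor 1/n cancels. -/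
theorem shintaniOp_algebraMap {n : ℕ} [NeZero n] (k : ℕ) (F : MvPowerSeries (Fin n) ℝ) :
    shintaniOp k (algebraMap _ (FracPS n) F) =
      (Nat.factorial k : ℝ) ^ n * MvPowerSeries.coeff (diagExp n k) F := by
  have h : ∀ j : Fin n, deltaJ k j (algebraMap _ (FracPS n) F) =
      MvPowerSeries.coeff (diagExp n k) F := by
    intro j
    have hz : IsZExpansion j (algebraMap _ (FracPS n) F) 0 (MvPowerSeries.subst (zVec j) F) := by
      refine ⟨F, 1, 0, isPowerful_one n, by simp, ?_⟩
      rw [MvPolynomial.coe_one, ← MvPowerSeries.coe_substAlgHom (hasSubst_zVec j), map_one]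
      simp
    rw [deltaJ_eq k hz, Finsupp.single_zero, add_zero, coeff_subst_zVec]
  rw [shintaniOp, Finset.sum_congr rfl fun j _ => h j, Finset.sum_const, Finset.card_univ,
    Fintype.card_fin, nsmul_eq_mul]
  have : (n : ℝ) ≠ 0 := Nat.cast_ne_zero.2 (NeZero.ne n)
  field_simp

/-! ## Exponential substitution -/

theorem factorial_pow_mul_coeff_linExp {n : ℕ} (k : ℕ) (c : Fin n → ℝ) :
    (Nat.factorial k : ℝ) ^ n * MvPowerSeries.coeff (diagExp n k) (linExp c) =
      (∏ j, c j) ^ k := by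
  change (Nat.factorial k : ℝ) ^ n * ∏ j, c j ^ diagExp n k j / (Nat.factorial (diagExp n k j) : ℝ)
    = _
  have : (Nat.factorial k : ℝ) ≠ 0 := Nat.cast_ne_zero.2 (Nat.factorial_ne_zero k)
  simp only [diagExp, Finsupp.equivFunOnFinite_symm_apply_apply, Finset.prod_div_distrib,
    Finset.prod_const, Finset.card_univ, Fintype.card_fin, Finset.prod_pow]
  field_simp

theorem constantCoeff_linExp {n : ℕ} (c : Fin n → ℝ) :
    MvPowerSeries.constantCoeff (linExp c) = 1 := by
  change ∏ j, c j ^ (0 : Fin n →₀ ℕ) j / (Nat.factorial ((0 : Fin n →₀ ℕ) j) : ℝ) = 1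
  simp

theorem expEval_single {n : ℕ} (M : Matrix (Fin n) (Fin n) ℝ) (m : Fin n → ℤ) (a : ℚ) :
    expEval M (AddMonoidAlgebra.single m a) = a • linExp ((fun i => (m i : ℝ)) ᵥ* M) := by
  simp [expEval, AddMonoidAlgebra.lift_single]

/-- The elements of `ℚ[x, x⁻¹]` whose exponential substitution preserves, for fixed `k`, the
integrality of the `(k, …, k)` coefficients after all twists by `e^{(v + m) · z Mᵗ}`. -/
def integralLaurent {n : ℕ} (R : Subring ℝ) (M : Matrix (Fin n) (Fin n) ℝ) (v : Fin n → ℝ)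
    (k : ℕ) : Subring (Laurent n) where
  carrier := {f | ∀ G : MvPowerSeries (Fin n) ℝ,
    (∀ m : Fin n → ℤ, (Nat.factorial k : ℝ) ^ n * MvPowerSeries.coeff (diagExp n k)
      (linExp ((fun i => v i + m i) ᵥ* M) * G) ∈ R) →
    ∀ m : Fin n → ℤ, (Nat.factorial k : ℝ) ^ n * MvPowerSeries.coeff (diagExp n k)
      (linExp ((fun i => v i + m i) ᵥ* M) * (expEval M f * G)) ∈ R}
  -- Quantifying over all G makes multiplication of Laurent polynomials a composition of stable
  -- operations.
  mul_mem' := by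
    intro f g hf hg G hG m
    rw [map_mul (expEval M), mul_assoc (expEval M f)]
    exact hf _ (hg _ hG) m
  one_mem' := by
    intro G hG m
    rw [map_one, one_mul]
    exact hG m
  add_mem' := by
    intro f g hf hg G hG m
    rw [map_add, add_mul, mul_add, map_add, mul_add]
    exact add_mem (hf G hG m) (hg G hG m)
  zero_mem' := by
    intro G hG m
    simp
  neg_mem' := by
    intro f hf G hG m
    rw [map_neg, neg_mul, mul_neg, map_neg, mul_neg]
    exact neg_mem (hf G hG m)

/-- Multiplication by x^d only replaces the twist m by m + d, and the hypothesis on G covers all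
twists. -/
theorem single_mem_integralLaurent {n : ℕ} {R : Subring ℝ} (M : Matrix (Fin n) (Fin n) ℝ)
    (v : Fin n → ℝ) (k : ℕ) (d : Fin n → ℤ) {a : ℚ} (ha : (a : ℝ) ∈ R) :
    AddMonoidAlgebra.single d a ∈ integralLaurent R M v k := by
  intro G hG m
  have h : linExp ((fun i => v i + m i) ᵥ* M) * (expEval M (AddMonoidAlgebra.single d a) * G) =
      (a : ℝ) • (linExp ((fun i => v i + ((m + d) i : ℤ)) ᵥ* M) * G) := by
    have h1 : (fun i => v i + (((m + d) i : ℤ) : ℝ)) =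
        (fun i => v i + m i) + (fun i => (d i : ℝ)) := by
      ext i
      simp [add_assoc]
    rw [expEval_single, h1, Matrix.add_vecMul, linExp_add, ← Rat.cast_smul_eq_qsmul ℝ,
      smul_mul_assoc, mul_smul_comm, mul_assoc]
  rw [h, MvPowerSeries.coeff_smul, mul_left_comm]
  exact mul_mem ha (hG (m + d))

theorem mem_integralLaurent {n : ℕ} {R : Subring ℝ} (M : Matrix (Fin n) (Fin n) ℝ)
    (v : Fin n → ℝ) (k : ℕ) {f : Laurent n} (hf : ∀ m, ((f.coeff m : ℚ) : ℝ) ∈ R) :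
    f ∈ integralLaurent R M v k := by
  have : f = ∑ m ∈ f.coeff.support, AddMonoidAlgebra.single m (f.coeff m) := by
    ext m
    simp [Finsupp.single_apply, Finsupp.finsetSum_apply]
  rw [this]
  exact sum_mem fun m _ => single_mem_integralLaurent M v k m (hf m)

theorem coeff_pow_mul_eq_zero {n : ℕ} {U F : MvPowerSeries (Fin n) ℝ}
    (hU : MvPowerSeries.constantCoeff U = 0) {K : ℕ} {r : Fin n →₀ ℕ} (hr : r.degree < K) :
    MvPowerSeries.coeff r (U ^ K * F) = 0 := by
  apply MvPowerSeries.coeff_of_lt_order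
  have h1 : (1 : ℕ∞) ≤ U.order := by
    rw [MvPowerSeries.one_le_order_iff_constCoeff_eq_zero]
    exact hU
  calc ((r.degree : ℕ) : ℕ∞) < K := by exact_mod_cast hr
    _ ≤ K • U.order := by
      rw [nsmul_eq_mul]
      simpa using mul_le_mul_right h1 (K : ℕ∞)
    _ ≤ (U ^ K).order := MvPowerSeries.le_order_pow _
    _ ≤ (U ^ K).order + F.order := le_self_add
    _ ≤ (U ^ K * F).order := MvPowerSeries.le_order_mul

/-- If `F = e^{v · z Mᵗ} V / B` with `V` and `B` integral at the exponentials and the value `b` of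
`B` at `1` invertible, then the normalized `(k, …, k)` coefficient of `F` is integral. -/
theorem factorial_pow_mul_coeff_mem {n : ℕ} {R : Subring ℝ} (M : Matrix (Fin n) (Fin n) ℝ)
    (v : Fin n → ℝ) (k : ℕ) (hM : ∀ m : Fin n → ℤ, ∏ j, ((fun i => v i + m i) ᵥ* M) j ∈ R)
    {V B : Laurent n} (hV : V ∈ integralLaurent R M v k) (hB : B ∈ integralLaurent R M v k)
    {b : ℚ} (hb : b ≠ 0) (hbR : ((b⁻¹ : ℚ) : ℝ) ∈ R)
    (hBb : MvPowerSeries.constantCoeff (expEval M B) = b)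
    {F : MvPowerSeries (Fin n) ℝ} (hF : F * expEval M B = linExp (v ᵥ* M) * expEval M V) :
    (Nat.factorial k : ℝ) ^ n * MvPowerSeries.coeff (diagExp n k) F ∈ R := by
  -- U = 1 - B/b has vanishing constant term after substitution, and W is the truncated geometric
  -- expansion of V/B. The cutoff K exceeds the total degree of (k, …, k), so U^K F does not reach
  -- that coefficient.
  let c : Laurent n := AddMonoidAlgebra.single 0 b⁻¹
  have hc : c ∈ integralLaurent R M v k := single_mem_integralLaurent M v k 0 hbR
  let U : Laurent n := 1 - c * B
  let K := (diagExp n k).degree + 1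
  let W : Laurent n := V * c * ∑ r ∈ Finset.range K, U ^ r
  have hU : U ∈ integralLaurent R M v k := sub_mem (one_mem _) (mul_mem hc hB)
  have hW : W ∈ integralLaurent R M v k :=
    mul_mem (mul_mem hV hc) (sum_mem fun r _ => pow_mem hU r)
  have hUc : MvPowerSeries.constantCoeff (expEval M U) = 0 := by
    have hcc : expEval M c = (b⁻¹ : ℚ) • (1 : MvPowerSeries (Fin n) ℝ) := by
      simp only [c]
      rw [expEval_single, show (fun i : Fin n => (((0 : Fin n → ℤ) i : ℤ) : ℝ)) = 0 by ext; simp,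
        Matrix.zero_vecMul, linExp_zero]
    rw [map_sub, map_one, map_sub, map_one, map_mul, map_mul, hcc, hBb,
      ← Rat.cast_smul_eq_qsmul ℝ, MvPowerSeries.constantCoeff_smul]
    simp [hb]
  have hgeom : (∑ r ∈ Finset.range K, U ^ r) * (c * B) = 1 - U ^ K := by
    rw [show c * B = 1 - U by simp [U], geom_sum_mul_neg]
  have key : F = linExp (v ᵥ* M) * (expEval M W * 1) + expEval M U ^ K * F := by
    have h1 := congrArg (expEval M) hgeom
    rw [map_mul, map_mul, map_sub, map_one, map_pow] at h1
    simp only [W, map_mul]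
    linear_combination (-F) * h1 + (expEval M (∑ r ∈ Finset.range K, U ^ r) * expEval M c) * hF
  rw [key, map_add, coeff_pow_mul_eq_zero hUc (Nat.lt_succ_self _), add_zero]
  -- For G = 1 the hypothesis on G is exactly the integrality of the k-th powers of the products in
  -- `hM`.
  have h0 := hW 1 (fun m => by
    rw [mul_one, factorial_pow_mul_coeff_linExp]
    exact pow_mem (hM m) k) 0
  simpa using h0

/-! ## The dilation `π_ℓ` -/

theorem piL_val (n : ℕ) [NeZero n] (ℓ : ℕ) [Fact ℓ.Prime] :
    (piL n ℓ).val = Matrix.diagonal fun i => if i = 0 then (ℓ : ℚ) else 1 := rfl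

theorem piL_inv_val (n : ℕ) [NeZero n] (ℓ : ℕ) [Fact ℓ.Prime] :
    ((piL n ℓ)⁻¹ : GL (Fin n) ℚ).val = Matrix.diagonal fun i => if i = 0 then (ℓ : ℚ)⁻¹ else 1 := by
  have h : (ℓ : ℚ) ≠ 0 := Nat.cast_ne_zero.2 (Fact.out : ℓ.Prime).ne_zero
  refine Units.inv_eq_of_mul_eq_one_right ?_
  rw [piL_val, Matrix.diagonal_mul_diagonal, ← Matrix.diagonal_one]
  congr 1
  ext i
  split_ifs <;> simp [h]

theorem toReal_diagonal {n : ℕ} (d : Fin n → ℚ) :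
    toReal (Matrix.diagonal d) = Matrix.diagonal fun i => (d i : ℝ) := by
  rw [toReal, Matrix.diagonal_map (by simp)]

theorem piL_mulVec {n : ℕ} [NeZero n] (ℓ : ℕ) [Fact ℓ.Prime] (x : Fin n → ℚ) (i : Fin n) :
    ((piL n ℓ).val *ᵥ x) i = (if i = 0 then (ℓ : ℚ) else 1) * x i := by
  rw [piL_val, Matrix.mulVec_diagonal]

theorem toReal_piL_mulVec {n : ℕ} [NeZero n] (ℓ : ℕ) [Fact ℓ.Prime] (x : Fin n → ℝ) (i : Fin n) :
    (toReal (piL n ℓ).val *ᵥ x) i = (if i = 0 then (ℓ : ℝ) else 1) * x i := by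
  rw [piL_val, toReal_diagonal, Matrix.mulVec_diagonal]
  split_ifs <;> simp

theorem toReal_piL_inv_mul_apply {n : ℕ} [NeZero n] (ℓ : ℕ) [Fact ℓ.Prime]
    (M : Matrix (Fin n) (Fin n) ℝ) (i j : Fin n) :
    (toReal ((piL n ℓ)⁻¹ : GL (Fin n) ℚ).val * M) i j =
      ((if i = 0 then (ℓ : ℚ)⁻¹ else 1 : ℚ) : ℝ) * M i j := by
  rw [piL_inv_val, toReal_diagonal, Matrix.diagonal_mul]

theorem vecMul_toReal_piL_inv_mul {n : ℕ} [NeZero n] (ℓ : ℕ) [Fact ℓ.Prime]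
    (M : Matrix (Fin n) (Fin n) ℝ) {x y : Fin n → ℝ}
    (h : ∀ i, y i = (if i = 0 then (ℓ : ℝ) else 1) * x i) :
    y ᵥ* (toReal ((piL n ℓ)⁻¹ : GL (Fin n) ℚ).val * M) = x ᵥ* M := by
  have hℓ : (ℓ : ℝ) ≠ 0 := Nat.cast_ne_zero.2 (Fact.out : ℓ.Prime).ne_zero
  ext j
  simp only [Matrix.vecMul, dotProduct, toReal_piL_inv_mul_apply, h]
  refine Finset.sum_congr rfl fun i _ => ?_
  split_ifs
  · push_cast
    field_simp
  · simp

theorem toReal_piL_inv_mul_mem_irrMat {n : ℕ} [NeZero n] (ℓ : ℕ) [Fact ℓ.Prime]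
    {M : Matrix (Fin n) (Fin n) ℝ} (hM : M ∈ irrMat n) :
    toReal ((piL n ℓ)⁻¹ : GL (Fin n) ℚ).val * M ∈ irrMat n := by
  have hℓ : (ℓ : ℚ) ≠ 0 := Nat.cast_ne_zero.2 (Fact.out : ℓ.Prime).ne_zero
  intro j
  have h := hM j
  rw [Fintype.linearIndependent_iff] at h ⊢
  intro g hg i
  have h1 := h (fun i => g i * (if i = 0 then (ℓ : ℚ)⁻¹ else 1)) (by
    rw [← hg]
    refine Finset.sum_congr rfl fun i _ => ?_
    simp only [toReal_piL_inv_mul_apply, Rat.smul_def]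
    push_cast
    ring) i
  rcases mul_eq_zero.1 h1 with h2 | h2
  · exact h2
  · split_ifs at h2
    · exact absurd h2 (inv_ne_zero hℓ)
    · exact absurd h2 one_ne_zero

/-- `π_ℓ` on integral vectors. -/
def piHom (n : ℕ) [NeZero n] (ℓ : ℕ) : (Fin n → ℤ) →+ (Fin n → ℤ) where
  toFun m i := (if i = 0 then (ℓ : ℤ) else 1) * m i
  map_zero' := by
    ext
    simp
  map_add' a b := by
    ext
    simp [mul_add]

theorem piHom_apply {n : ℕ} [NeZero n] (ℓ : ℕ) (m : Fin n → ℤ) (i : Fin n) :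
    piHom n ℓ m i = (if i = 0 then (ℓ : ℤ) else 1) * m i := rfl

theorem piHom_injective (n : ℕ) [NeZero n] (ℓ : ℕ) [Fact ℓ.Prime] :
    Function.Injective (piHom n ℓ) := by
  have hℓ : (ℓ : ℤ) ≠ 0 := Nat.cast_ne_zero.2 (Fact.out : ℓ.Prime).ne_zero
  intro a b h
  ext i
  have := congrFun h i
  simp only [piHom_apply] at this
  split_ifs at this
  · exact mul_left_cancel₀ hℓ this
  · simpa using this

/-- At a point π m, the translates by the π d only see values of T on the image of π. -/
theorem laurentAct_mapDomain {n : ℕ} (π : (Fin n → ℤ) →+ (Fin n → ℤ)) (p : Laurent n)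
    (T : (Fin n → ℤ) → ℚ) (m : Fin n → ℤ) :
    laurentAct n (AddMonoidAlgebra.mapDomainRingHom ℚ π p) T (π m) =
      laurentAct n p (fun m => T (π m)) m := by
  induction p using AddMonoidAlgebra.induction_linear with
  | zero => simp
  | add f g hf hg => simp only [map_add, LinearMap.add_apply, Pi.add_apply, hf, hg]
  | single d c =>
    rw [AddMonoidAlgebra.mapDomainRingHom_apply, AddMonoidAlgebra.mapDomain_single,
      laurentAct_single, laurentAct_single, ← map_sub]

theorem expEval_mapDomain_piHom {n : ℕ} [NeZero n] (ℓ : ℕ) [Fact ℓ.Prime]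
    (M : Matrix (Fin n) (Fin n) ℝ) (p : Laurent n) :
    expEval (toReal ((piL n ℓ)⁻¹ : GL (Fin n) ℚ).val * M)
      (AddMonoidAlgebra.mapDomainRingHom ℚ (piHom n ℓ) p) = expEval M p := by
  induction p using AddMonoidAlgebra.induction_linear with
  | zero => simp
  | add f g hf hg => simp only [map_add, hf, hg]
  | single d c =>
    rw [AddMonoidAlgebra.mapDomainRingHom_apply, AddMonoidAlgebra.mapDomain_single,
      expEval_single, expEval_single, vecMul_toReal_piL_inv_mul ℓ M (x := fun i => (d i : ℝ))]
    intro i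
    change ((piHom n ℓ d i : ℤ) : ℝ) = _
    rw [piHom_apply]
    push_cast
    rfl

/-! ## Equivariance of `Φ_Sh` -/

theorem cQ_map {n r : ℕ} (e : (Fin n → ℝ) ≃ₗ[ℝ] (Fin n → ℝ)) {a : ℝ} (ha : 0 < a)
    (Q : Fin n → ℝ) (w : Fin r → Fin n → ℝ) (x : Fin n → ℝ) :
    cQ (e Q) (fun i => a • e (w i)) (e x) = cQ Q w x := by
  classical
  have h1 : LinearIndependent ℝ (fun i => a • e (w i)) ↔ LinearIndependent ℝ w := by
    exact LinearMap.linearIndependent_iff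
      (e.trans (LinearEquiv.smulOfNeZero ℝ (Fin n → ℝ) a ha.ne')).toLinearMap (LinearEquiv.ker _)
  have h2 : ∀ y, e y ∈ openCone (fun i => a • e (w i)) ↔ y ∈ openCone w := by
    intro y
    constructor
    · rintro ⟨t, ht, h⟩
      refine ⟨fun i => t i * a, fun i => mul_pos (ht i) ha, e.injective ?_⟩
      rw [h, map_sum]
      exact Finset.sum_congr rfl fun i _ => by rw [map_smul, mul_smul]
    · rintro ⟨t, ht, rfl⟩
      refine ⟨fun i => t i * a⁻¹, fun i => mul_pos (ht i) (inv_pos.2 ha), ?_⟩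
      rw [map_sum]
      refine Finset.sum_congr rfl fun i _ => ?_
      rw [map_smul, smul_smul, mul_assoc, inv_mul_cancel₀ ha.ne', mul_one]
  have h3 : ∀ ε : ℝ, e x + ε • e Q = e (x + ε • Q) := fun ε => by rw [map_add, map_smul]
  simp only [cQ, h1, h3, h2]

theorem firstCols_piL_conj {n : ℕ} [NeZero n] (ℓ : ℕ) [Fact ℓ.Prime] (A : Fin n → GL (Fin n) ℚ)
    (r i : Fin n) : firstCols (fun i => piL n ℓ * A i * (piL n ℓ)⁻¹) r i =
      (ℓ : ℚ)⁻¹ * ((if r = 0 then (ℓ : ℚ) else 1) * firstCols A r i) := by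
  simp only [firstCols, Matrix.of_apply, Units.val_mul]
  rw [piL_inv_val, Matrix.mul_diagonal, piL_val, Matrix.diagonal_mul, if_pos rfl]
  ring

/-- The first column of π_ℓ A_i π_ℓ⁻¹ is ℓ⁻¹ π_ℓ σ_i. Positive scaling does not change a cone, and
det π_ℓ > 0, so the sign is preserved while the cone and Q are transported by π_ℓ. -/
theorem phiSh_piL_conj {n : ℕ} [NeZero n] (ℓ : ℕ) [Fact ℓ.Prime] (A : Fin n → GL (Fin n) ℚ)
    (Q x y : Fin n → ℝ) (hy : ∀ i, y i = (if i = 0 then (ℓ : ℝ) else 1) * x i) :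
    phiSh (fun i => piL n ℓ * A i * (piL n ℓ)⁻¹) (toReal (piL n ℓ).val *ᵥ Q) y = phiSh A Q x := by
  have hℓ : 0 < ℓ := (Fact.out : ℓ.Prime).pos
  have hdet : SignType.sign (firstCols (fun i => piL n ℓ * A i * (piL n ℓ)⁻¹)).det =
      SignType.sign (firstCols A).det := by
    have h1 : firstCols (fun i => piL n ℓ * A i * (piL n ℓ)⁻¹) =
        (ℓ : ℚ)⁻¹ • ((Matrix.diagonal fun i => if i = 0 then (ℓ : ℚ) else 1) * firstCols A) := by
      ext r i
      rw [firstCols_piL_conj, Matrix.smul_apply, Matrix.diagonal_mul, smul_eq_mul]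
    have h2 : (0 : ℚ) < (ℓ : ℚ)⁻¹ ^ Fintype.card (Fin n) := by positivity
    have h3 : (0 : ℚ) < ∏ i : Fin n, if i = 0 then (ℓ : ℚ) else 1 :=
      Finset.prod_pos fun i _ => by split_ifs <;> positivity
    rw [h1, Matrix.det_smul, Matrix.det_mul, Matrix.det_diagonal, sign_mul, sign_mul, sign_pos h2,
      sign_pos h3, one_mul, one_mul]
  have hd : ∀ i : Fin n, (if i = 0 then (ℓ : ℝ) else 1) ≠ 0 := fun i => by
    split_ifs <;> positivity
  let e : (Fin n → ℝ) ≃ₗ[ℝ] (Fin n → ℝ) :=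
    LinearEquiv.piCongrRight fun i => LinearEquiv.smulOfNeZero ℝ ℝ _ (hd i)
  have he : ∀ z i, e z i = (if i = 0 then (ℓ : ℝ) else 1) * z i := fun z i => rfl
  have hQ : toReal (piL n ℓ).val *ᵥ Q = e Q := by
    ext i
    rw [toReal_piL_mulVec, he]
  have hx : y = e x := by
    ext i
    rw [hy, he]
  have hw : (fun i r => ((firstCols (fun i => piL n ℓ * A i * (piL n ℓ)⁻¹) r i : ℚ) : ℝ)) =
      fun i => (ℓ : ℝ)⁻¹ • e (fun r => ((firstCols A r i : ℚ) : ℝ)) := by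
    ext i r
    rw [firstCols_piL_conj, Pi.smul_apply, he]
    split_ifs <;> simp
  rw [phiSh, phiSh, hdet, hQ, hx, hw, cQ_map e (by positivity)]

/-! ## Generators of the cones -/

theorem exists_int_mul_of_isLocalInt {n ℓ : ℕ} [Fact ℓ.Prime] {x : Fin n → ℚ}
    (hx : ∀ j, IsLocalInt ℓ (x j)) :
    ∃ N : ℕ, ¬ ℓ ∣ N ∧ ∀ j, ∃ a : ℤ, (a : ℚ) = N * x j := by
  refine ⟨∏ j, (x j).den, ?_, fun j => ?_⟩
  · rw [Prime.dvd_finsetProd_iff (Nat.Prime.prime Fact.out)]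
    rintro ⟨j, _, h⟩
    exact hx j h
  · refine ⟨(∏ i ∈ Finset.univ.erase j, ((x i).den : ℤ)) * (x j).num, ?_⟩
    rw [← Finset.prod_erase_mul _ _ (Finset.mem_univ j)]
    push_cast
    rw [mul_assoc, mul_comm ((x j).den : ℚ), Rat.mul_den_eq_num]

/-- Divisibility of the lower entries of the first column makes ℓ⁻¹ π_ℓ σ ℓ-integral; its entry at
index 0 is A_00, an ℓ-unit. Denominators prime to ℓ are cleared, and a further factor prime to ℓ
normalizes that entry to 1 mod ℓ. -/
theorem exists_generator {n ℓ : ℕ} [NeZero n] [Fact ℓ.Prime] {A : GL (Fin n) ℚ}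
    (hA : A ∈ gammaL n ℓ) :
    ∃ (c : ℕ) (ρ : Fin n → ℤ), 0 < c ∧ (ρ 0 : ZMod ℓ) = 1 ∧
      ∀ j, (ρ j : ℚ) = c * ((ℓ : ℚ)⁻¹ * ((if j = 0 then (ℓ : ℚ) else 1) * A.val j 0)) := by
  obtain ⟨h1, h2, h3⟩ := hA
  have hℓ : (ℓ : ℚ) ≠ 0 := Nat.cast_ne_zero.2 (Fact.out : ℓ.Prime).ne_zero
  have hloc : ∀ j, IsLocalInt ℓ ((ℓ : ℚ)⁻¹ * ((if j = 0 then (ℓ : ℚ) else 1) * A.val j 0)) := by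
    intro j
    by_cases hj : j = 0
    · rw [if_pos hj, inv_mul_cancel_left₀ hℓ]
      exact h1 j 0
    · obtain ⟨y, hy, hjy⟩ := h3 j hj
      rw [if_neg hj, one_mul, hjy, inv_mul_cancel_left₀ hℓ]
      exact hy
  obtain ⟨N, hN, hNa⟩ := exists_int_mul_of_isLocalInt hloc
  obtain ⟨N', hN', hNb⟩ := exists_int_mul_of_isLocalInt (h2 0)
  choose a ha using hNa
  choose b hb using hNb
  -- Otherwise ℓ divides the whole first column of N·A; pairing it with the first row of N'·A⁻¹
  -- gives ℓ ∣ N'N, although N and N' are prime to ℓ.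
  have hne : (a 0 : ZMod ℓ) ≠ 0 := by
    intro h0
    rw [ZMod.intCast_zmod_eq_zero_iff_dvd] at h0
    obtain ⟨a', ha'⟩ := h0
    have hcol : ∀ j, ∃ f : ℤ, (N : ℚ) * A.val j 0 = ℓ * f := by
      intro j
      by_cases hj : j = 0
      · subst hj
        refine ⟨a', ?_⟩
        have := ha 0
        rw [if_pos rfl, inv_mul_cancel_left₀ hℓ, ha'] at this
        rw [← this]
        push_cast
        rfl
      · refine ⟨a j, ?_⟩
        rw [ha j, if_neg hj]
        field_simp
    choose f hf using hcol
    have hinv : ∑ j, (A⁻¹).val 0 j * A.val j 0 = 1 := by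
      have h := congrFun (congrFun (Units.inv_mul A) 0) 0
      rw [Matrix.mul_apply, Matrix.one_apply_eq] at h
      exact h
    have key : ((N' * N : ℕ) : ℤ) = ℓ * ∑ j, b j * f j := by
      have : (((N' * N : ℕ) : ℤ) : ℚ) = ((ℓ * ∑ j, b j * f j : ℤ) : ℚ) := by
        push_cast
        rw [← mul_one ((N' : ℚ) * N), ← hinv, Finset.mul_sum, Finset.mul_sum]
        refine Finset.sum_congr rfl fun j _ => ?_
        rw [hb]
        linear_combination (N' * (A⁻¹).val 0 j) * hf j
      exact_mod_cast this
    have hdvd : ℓ ∣ N' * N := by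
      exact_mod_cast Dvd.intro _ key.symm
    rcases (Nat.Prime.dvd_mul Fact.out).1 hdvd with h | h
    · exact hN' h
    · exact hN h
  -- The natural representative of the inverse keeps the scaling factor positive, so the ray is
  -- unchanged.
  have hs : 0 < ((a 0 : ZMod ℓ)⁻¹).val := by
    rw [ZMod.val_pos]
    exact inv_ne_zero hne
  refine ⟨((a 0 : ZMod ℓ)⁻¹).val * N, fun j => ((a 0 : ZMod ℓ)⁻¹).val * a j, ?_, ?_, ?_⟩
  · refine Nat.mul_pos hs (Nat.pos_of_ne_zero ?_)
    rintro rfl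
    exact hN (dvd_zero ℓ)
  · push_cast
    rw [ZMod.natCast_zmod_val, inv_mul_cancel₀ hne]
  · intro j
    push_cast
    rw [ha]
    ring

/-! ## The denominators -/

/-- The linear coefficient in z_0 is -(ρM)_0, a nontrivial rational combination of the entries of
one column of M. -/
theorem expEval_one_sub_single_ne_zero {n : ℕ} [NeZero n] {M : Matrix (Fin n) (Fin n) ℝ}
    (hM : M ∈ irrMat n) {ρ : Fin n → ℤ} (hρ : ρ ≠ 0) :
    expEval M (1 - AddMonoidAlgebra.single ρ 1) ≠ 0 := by
  classical
  intro h
  rw [map_sub, map_one, expEval_single, one_smul] at h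
  have h1 := congrArg (MvPowerSeries.coeff (Finsupp.single (0 : Fin n) 1)) h
  rw [map_sub, map_zero, MvPowerSeries.coeff_one, if_neg (by simp), zero_sub, neg_eq_zero] at h1
  have h2 : MvPowerSeries.coeff (Finsupp.single (0 : Fin n) 1)
      (linExp ((fun i => (ρ i : ℝ)) ᵥ* M)) = ((fun i => (ρ i : ℝ)) ᵥ* M) 0 := by
    change ∏ j, _ ^ Finsupp.single (0 : Fin n) 1 j /
      (Nat.factorial (Finsupp.single (0 : Fin n) 1 j) : ℝ) = _
    rw [Finset.prod_eq_single 0]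
    · simp
    · intro j _ hj
      simp [hj]
    · simp
  rw [h2] at h1
  have h3 := Fintype.linearIndependent_iff.1 (hM 0) (fun i => (ρ i : ℚ)) (by
    rw [← h1]
    simp [Matrix.vecMul, dotProduct, Rat.smul_def])
  exact hρ (funext fun i => by simpa using h3 i)

theorem monoPoly_one {n : ℕ} (ℓ : ℕ) (ρ : Fin n → ℤ) :
    monoPoly ℓ (fun _ => 1) ρ = ∑ j ∈ Finset.range ℓ, (AddMonoidAlgebra.single ρ 1 : Laurent n) ^ j :=
  Finset.sum_congr rfl fun j _ => by rw [AddMonoidAlgebra.single_pow, one_pow]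

/-- The coefficients of `1 - y^ℓ`. -/
def oneSubPow (ℓ : ℕ) (j : ℕ) : ℚ := (if j = 0 then 1 else 0) - if j = ℓ then 1 else 0

theorem sum_oneSubPow (ℓ : ℕ) (f : ℕ → ℚ) :
    ∑ j ∈ Finset.range (ℓ + 1), oneSubPow ℓ j * f j = f 0 - f ℓ := by
  simp [oneSubPow, sub_mul, Finset.sum_sub_distrib]

theorem monoPoly_oneSubPow {n : ℕ} (ℓ : ℕ) (ρ : Fin n → ℤ) :
    monoPoly (ℓ + 1) (oneSubPow ℓ) ρ = 1 - AddMonoidAlgebra.single (ℓ • ρ) 1 := by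
  have : ∀ j, (AddMonoidAlgebra.single (j • ρ) (oneSubPow ℓ j) : Laurent n) =
      (if j = 0 then AddMonoidAlgebra.single (j • ρ) 1 else 0) -
        if j = ℓ then AddMonoidAlgebra.single (j • ρ) 1 else 0 := by
    intro j
    rw [oneSubPow, AddMonoidAlgebra.single_sub]
    split_ifs <;> simp
  simp only [monoPoly, this, Finset.sum_sub_distrib, Finset.sum_ite_eq']
  simp [AddMonoidAlgebra.one_def]

theorem monoPoly_oneSubPow_eq_mul {n : ℕ} (ℓ : ℕ) (ρ : Fin n → ℤ) :
    monoPoly (ℓ + 1) (oneSubPow ℓ) ρ =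
      (1 - AddMonoidAlgebra.single ρ 1) * monoPoly ℓ (fun _ => 1) ρ := by
  rw [monoPoly_oneSubPow, monoPoly_one, mul_neg_geom_sum, AddMonoidAlgebra.single_pow, one_pow]

theorem constantCoeff_expEval_monoPoly_one {n : ℕ} (M : Matrix (Fin n) (Fin n) ℝ) (ℓ : ℕ)
    (ρ : Fin n → ℤ) :
    MvPowerSeries.constantCoeff (expEval M (monoPoly ℓ (fun _ => 1) ρ)) = ℓ := by
  rw [monoPoly, map_sum, map_sum]
  simp [expEval_single, constantCoeff_linExp]

/-! ## The smoothed cocycle as a power series -/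

theorem sum_ite_sub_eq_zero (ℓ : ℕ) [Fact ℓ.Prime] (b : ZMod ℓ) :
    ∑ j ∈ Finset.range ℓ, (if b - j = 0 then (1 : ℚ) else 0) = 1 := by
  rw [Finset.sum_eq_single b.val]
  · simp
  · intro j hj hjb
    rw [if_neg]
    intro h
    apply hjb
    rw [sub_eq_zero.1 h, ZMod.val_natCast_of_lt (Finset.mem_range.1 hj)]
  · intro h
    exact absurd (Finset.mem_range.2 (ZMod.val_lt b)) h

/-- The smoothed cocycle is `e^{v' · z M'ᵗ} V / B`, where `M' = π_ℓ⁻¹ M`, `v' = π_ℓ v`, `V` is a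
Laurent polynomial with integral coefficients and `B` is the product of the polynomials
`1 + y + ⋯ + y^{ℓ-1}` in monomials `y = x^{ρ_i}`. -/
theorem psiShL_mul_eq {n : ℕ} [NeZero n] (ℓ : ℕ) [Fact ℓ.Prime]
    {A : Fin n → GL (Fin n) ℚ} (hA : ∀ i, A i ∈ gammaL n ℓ)
    {M : Matrix (Fin n) (Fin n) ℝ} (hM : M ∈ irrMat n) (Q : Fin n → ℝ) (v : Fin n → ℚ) :
    ∃ (ρ : Fin n → Fin n → ℤ) (V : Laurent n),
      (∀ m, V.coeff m ∈ Set.range ((↑) : ℤ → ℚ)) ∧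
      psiShL ℓ A M Q v * algebraMap _ (FracPS n)
        (expEval (toReal ((piL n ℓ)⁻¹ : GL (Fin n) ℚ).val * M)
          (∏ i, monoPoly ℓ (fun _ => 1) (ρ i))) =
      algebraMap _ (FracPS n) (linExp ((fun i => ((v i : ℚ) : ℝ)) ᵥ* M) *
        expEval (toReal ((piL n ℓ)⁻¹ : GL (Fin n) ℚ).val * M) V) := by
  classical
  have hℓ : ℓ ≠ 0 := (Fact.out : ℓ.Prime).ne_zero
  choose c ρ hc hρ0 hρ using fun i => exists_generator (hA i)
  set M' := toReal ((piL n ℓ)⁻¹ : GL (Fin n) ℚ).val * M with hM'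
  have hM'irr : M' ∈ irrMat n := toReal_piL_inv_mul_mem_irrMat ℓ hM
  set A' : Fin n → GL (Fin n) ℚ := fun i => piL n ℓ * A i * (piL n ℓ)⁻¹ with hA'
  set Q' := toReal (piL n ℓ).val *ᵥ Q with hQ'
  set v' := (piL n ℓ).val *ᵥ v with hv'
  let S' := genSeries (phiSh A' Q') v'
  let δ : ZMod ℓ → ℚ := fun b => if b = 0 then 1 else 0
  let P' : Laurent n := ∏ i, monoPoly (ℓ + 1) (oneSubPow ℓ) (ρ i)
  let Y : Laurent n := ∏ i, (1 - AddMonoidAlgebra.single (ρ i) 1)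
  let B : Laurent n := ∏ i, monoPoly ℓ (fun _ => 1) (ρ i)
  have hP'YB : P' = Y * B := by
    simp only [P', Y, B, ← Finset.prod_mul_distrib]
    exact Finset.prod_congr rfl fun i _ => monoPoly_oneSubPow_eq_mul ℓ (ρ i)
  have hcone : ∀ (u : ZMod ℓ → ℚ) (N : ℕ) (a : ℕ → ℚ),
      (∀ b : ZMod ℓ, ∑ j ∈ Finset.range N, a j * u (b - j) = 0) →
      ∃ q : Laurent n, laurentSeries q =
        laurentAct n (∏ i, monoPoly N a (ρ i)) (fun m => u (m 0) * S' m) := by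
    intro u N a hau
    obtain ⟨q, hq⟩ := exists_laurent_weighted_cone (ℓ := ℓ) Q'
      (fun i r => ((firstCols A' r i : ℚ) : ℝ)) (fun i => (c i : ℝ))
      (fun i => Nat.cast_pos.2 (hc i)) ρ (fun i j => by
        rw [hA', firstCols_piL_conj]
        exact_mod_cast congrArg (Rat.cast : ℚ → ℝ) (hρ i j)) hρ0
      ((SignType.sign (firstCols A').det : SignType) : ℤ) (fun i => ((v' i : ℚ) : ℝ)) u a hau
    refine ⟨q, hq.trans ?_⟩
    congr 1
    ext m
    simp only [S', genSeries, phiSh]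
    push_cast
    rfl
  have hone : ∀ u : ZMod ℓ → ℚ, ∀ b : ZMod ℓ,
      ∑ j ∈ Finset.range (ℓ + 1), oneSubPow ℓ j * u (b - j) = 0 := by
    intro u b
    rw [sum_oneSubPow ℓ fun j => u (b - j)]
    simp
  -- Three numerators over the same cone: the full series and its part with ℓ ∣ m_0, both cleared by
  -- the 1 - y_i^ℓ, and the series with weight 1 - ℓδ, for which 1 + ⋯ + y_i^{ℓ-1} suffices.
  obtain ⟨q', hq'⟩ := hcone (fun _ => 1) (ℓ + 1) (oneSubPow ℓ) (hone fun _ => 1)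
  obtain ⟨q₀, hq₀⟩ := hcone δ (ℓ + 1) (oneSubPow ℓ) (hone _)
  obtain ⟨V, hV⟩ := hcone (fun b => 1 - ℓ * δ b) ℓ (fun _ => 1) (fun b => by
    simp only [one_mul, Finset.sum_sub_distrib, ← Finset.mul_sum, δ, sum_ite_sub_eq_zero]
    simp)
  simp only [one_mul] at hq'
  let πs : Laurent n →+* Laurent n := AddMonoidAlgebra.mapDomainRingHom ℚ (piHom n ℓ)
  -- the part of the numerator supported on the sublattice
  have hsupp : ↑q₀.coeff.support ⊆ Set.range (piHom n ℓ) := by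
    intro m hm
    have h1 : (m 0 : ZMod ℓ) = 0 := by
      by_contra hcon
      refine Finsupp.mem_support_iff.1 hm ?_
      change laurentSeries q₀ m = 0
      rw [hq₀]
      refine laurentAct_prod_induction (fun S => ∀ m : Fin n → ℤ, (m 0 : ZMod ℓ) ≠ 0 → S m = 0)
        _ _ ?_ ?_ m hcon
      · intro i _ S hS m hm
        rw [monoPoly_oneSubPow, map_sub, map_one, LinearMap.sub_apply, Pi.sub_apply,
          laurentAct_single, Module.End.one_apply, hS m hm, hS, mul_zero, sub_zero]
        simpa using hm
      · intro m hm
        simp [δ, hm]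
    rw [ZMod.intCast_zmod_eq_zero_iff_dvd] at h1
    obtain ⟨k, hk⟩ := h1
    refine ⟨fun i => if i = 0 then k else m i, ?_⟩
    ext i
    rw [piHom_apply]
    split_ifs with hi
    · rw [hi, hk]
    · rw [one_mul]
  let q : Laurent n := AddMonoidAlgebra.comapDomain (piHom n ℓ) (piHom_injective n ℓ) q₀
  have hq : πs q = q₀ := AddMonoidAlgebra.mapDomain_comapDomain hsupp _
  -- Chosen so that π_ℓ σ_i = ℓρ_i; thus P is the pullback of P' along π_ℓ.
  let σ : Fin n → Fin n → ℤ := fun i j => if j = 0 then ρ i j else ℓ * ρ i j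
  let P : Laurent n := ∏ i, (1 - AddMonoidAlgebra.single (σ i) 1)
  have hP : πs P = P' := by
    simp only [P, P', πs, map_prod, map_sub, map_one]
    refine Finset.prod_congr rfl fun i _ => ?_
    rw [monoPoly_oneSubPow, AddMonoidAlgebra.mapDomainRingHom_apply,
      AddMonoidAlgebra.mapDomain_single]
    congr 2
    ext j
    rw [piHom_apply]
    by_cases hj : j = 0 <;> simp [σ, hj]
  -- denominators do not vanish
  have hρne : ∀ i, ρ i ≠ 0 := by
    intro i h
    have := hρ0 i
    simp [h] at this
  have hEP' : expEval M' P' ≠ 0 := by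
    simp only [P', map_prod, monoPoly_oneSubPow]
    exact Finset.prod_ne_zero_iff.2 fun i _ =>
      expEval_one_sub_single_ne_zero hM'irr (smul_ne_zero hℓ (hρne i))
  have hEπ : ∀ f, expEval M' (πs f) = expEval M f := expEval_mapDomain_piHom ℓ M
  have hEP : expEval M P ≠ 0 := by
    rw [← hEπ, hP]
    exact hEP'
  have hS : ∀ m, genSeries (phiSh A Q) v m = S' (piHom n ℓ m) := by
    intro m
    simp only [S', genSeries]
    rw [phiSh_piL_conj ℓ A Q (fun i => ((v i + m i : ℚ) : ℝ))]
    intro i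
    rw [hv', piL_mulVec, piHom_apply]
    split_ifs
    · push_cast
      ring
    · simp
  have hgen' : IsGenFun (phiSh A' Q') v' P' q' :=
    ⟨fun h => hEP' (by rw [h, map_zero]), hq'.symm⟩
  have hgen : IsGenFun (phiSh A Q) v P q := by
    refine ⟨fun h => hEP (by rw [h, map_zero]), ?_⟩
    ext m
    have h1 : laurentSeries q m = laurentSeries q₀ (piHom n ℓ m) := rfl
    have h2 : genSeries (phiSh A Q) v = fun m => (fun m' => δ (m' 0) * S' m') (piHom n ℓ m) := by
      ext m
      simp [hS, piHom_apply, δ]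
    rw [h1, hq₀, h2]
    exact (laurentAct_mapDomain (piHom n ℓ) P (fun m' => δ (m' 0) * S' m') m).symm.trans
      (congrArg (fun p => laurentAct n p (fun m' => δ (m' 0) * S' m') (piHom n ℓ m)) hP)
  have hexp : ∀ {N : Matrix (Fin n) (Fin n) ℝ} {p r : Laurent n}, expEval N p ≠ 0 →
      expSubst N (algebraMap (Laurent n) (RatFun n) r / algebraMap (Laurent n) (RatFun n) p) =
        algebraMap _ (FracPS n) (expEval N r) / algebraMap _ (FracPS n) (expEval N p) := by
    intro N p r hp
    refine expSubst_eq ⟨hp, div_mul_cancel₀ _ ?_⟩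
    rw [map_ne_zero_iff _ (FaithfulSMul.algebraMap_injective (Laurent n) (RatFun n))]
    rintro rfl
    exact hp (map_zero _)
  have hlin : linExp ((fun i => ((v' i : ℚ) : ℝ)) ᵥ* M') =
      linExp ((fun i => ((v i : ℚ) : ℝ)) ᵥ* M) := by
    rw [hM', vecMul_toReal_piL_inv_mul ℓ M (x := fun i => ((v i : ℚ) : ℝ))]
    intro i
    rw [hv', piL_mulVec]
    split_ifs <;> simp
  -- the numerators
  have hnum : q' - (ℓ : Laurent n) * πs q = Y * V := by
    apply laurentSeries_injective
    have h1 : (fun m : Fin n → ℤ => (1 - ℓ * δ (m 0)) * S' m) =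
        S' - (ℓ : ℚ) • fun m => δ (m 0) * S' m := by
      ext m
      simp only [Pi.sub_apply, Pi.smul_apply, smul_eq_mul]
      ring
    have h2 : laurentSeries (q' - (ℓ : Laurent n) * πs q) =
        laurentSeries q' - (ℓ : ℚ) • laurentSeries q₀ := by
      rw [hq, ← nsmul_eq_mul, ← Nat.cast_smul_eq_nsmul ℚ]
      rfl
    rw [h2, ← laurentAct_series, hV, ← laurentAct_mul, ← hP'YB, h1, map_sub, map_smul, hq', hq₀]
  refine ⟨ρ, V, fun m => ?_, ?_⟩
  · change laurentSeries V m ∈ _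
    rw [hV]
    refine laurentAct_prod_monoPoly_int (fun _ => ⟨1, Int.cast_one⟩) ρ (fun m => ?_) m
    refine ⟨(1 - ℓ * if (m 0 : ZMod ℓ) = 0 then 1 else 0) *
      phiSh A' Q' (fun i => ((v' i + m i : ℚ) : ℝ)), ?_⟩
    simp only [S', genSeries, δ]
    push_cast
    rfl
  · have hne : algebraMap _ (FracPS n) (expEval M' P') ≠ 0 :=
      (map_ne_zero_iff _ (FaithfulSMul.algebraMap_injective _ (FracPS n))).2 hEP'
    rw [psiShL, psiSh, psiSh, solomonHu, solomonHu, coneGen_eq hgen', coneGen_eq hgen, hexp hEP',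
      hexp hEP, hlin, ← hEπ P, ← hEπ q, hP]
    have hE : expEval M' q' - (ℓ : MvPowerSeries (Fin n) ℝ) * expEval M' (πs q) =
        expEval M' Y * expEval M' V := by
      rw [← map_natCast (expEval M') ℓ, ← map_mul, ← map_sub, hnum, map_mul]
    have hE2 : expEval M' P' = expEval M' Y * expEval M' B := by
      rw [hP'YB, map_mul]
    have hE' := congrArg (algebraMap _ (FracPS n)) hE
    have hE2' := congrArg (algebraMap _ (FracPS n)) hE2
    rw [map_sub, map_mul, map_mul, map_natCast] at hE'
    rw [map_mul] at hE2'
    rw [map_mul]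
    apply mul_right_cancel₀ hne
    rw [mul_assoc, mul_comm _ (algebraMap _ (FracPS n) (expEval M' P')), ← mul_assoc, sub_mul]
    have e1 : ∀ x y : FracPS n, x * (y / algebraMap _ (FracPS n) (expEval M' P')) *
        algebraMap _ (FracPS n) (expEval M' P') = x * y := fun x y => by
      rw [mul_assoc, div_mul_cancel₀ _ hne]
    rw [e1, mul_assoc (ℓ : FracPS n), e1, hE2']
    linear_combination (algebraMap _ (FracPS n) (linExp ((fun i => ((v i : ℚ) : ℝ)) ᵥ* M)) *
      algebraMap _ (FracPS n) (expEval M' B)) * hE'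

/-- The smoothed cocycle is a power series whose images under the Shintani operators are
`ℓ`-integral. -/
theorem psiShL_mem_hd_and_shintaniOp_mem {n : ℕ} [NeZero n] (ℓ : ℕ) [Fact ℓ.Prime]
    {A : Fin n → GL (Fin n) ℚ} (hA : ∀ i, A i ∈ gammaL n ℓ)
    {M : Matrix (Fin n) (Fin n) ℝ} (hM : M ∈ irrMat n) (Q : Fin n → ℝ) (v : Fin n → ℚ)
    (hf : ∀ x ∈ latticeL n ℓ, normForm M (fun i => ((v i + x i : ℚ) : ℝ)) ∈ zInv ℓ) :
    psiShL ℓ A M Q v ∈ hd n ∧ ∀ k : ℕ, shintaniOp k (psiShL ℓ A M Q v) ∈ zInv ℓ := by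
  have hℓ : ℓ ≠ 0 := (Fact.out : ℓ.Prime).ne_zero
  obtain ⟨ρ, V, hV, hψ⟩ := psiShL_mul_eq ℓ hA hM Q v
  set M' := toReal ((piL n ℓ)⁻¹ : GL (Fin n) ℚ).val * M with hM'
  set B : Laurent n := ∏ i, monoPoly ℓ (fun _ => 1) (ρ i) with hB
  have hBc : MvPowerSeries.constantCoeff (expEval M' B) = (((ℓ : ℚ) ^ n : ℚ) : ℝ) := by
    rw [hB, map_prod, map_prod]
    simp [constantCoeff_expEval_monoPoly_one]
  have hBc0 : MvPowerSeries.constantCoeff (expEval M' B) ≠ 0 := by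
    rw [hBc]
    exact_mod_cast pow_ne_zero n hℓ
  obtain ⟨F, hF⟩ : ∃ F : MvPowerSeries (Fin n) ℝ, F = linExp ((fun i => ((v i : ℚ) : ℝ)) ᵥ* M) *
    expEval M' V * (expEval M' B)⁻¹ := ⟨_, rfl⟩
  have hFB : F * expEval M' B = linExp ((fun i => ((v i : ℚ) : ℝ)) ᵥ* M) * expEval M' V := by
    rw [hF, mul_assoc, MvPowerSeries.inv_mul_cancel _ hBc0, mul_one]
  have hψF : psiShL ℓ A M Q v = algebraMap _ (FracPS n) F := by
    have hne : algebraMap _ (FracPS n) (expEval M' B) ≠ 0 := by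
      rw [map_ne_zero_iff _ (FaithfulSMul.algebraMap_injective _ (FracPS n))]
      intro h
      exact hBc0 (by rw [h, map_zero])
    apply mul_right_cancel₀ hne
    rw [hψ, ← hFB, map_mul]
  rw [hψF]
  refine ⟨algebraMap_mem_hd F, fun k => ?_⟩
  rw [shintaniOp_algebraMap]
  -- This is π_ℓ v; the pair (v', M') gives the same exponential as (v, M).
  let v' : Fin n → ℝ := fun i => (if i = 0 then (ℓ : ℝ) else 1) * ((v i : ℚ) : ℝ)
  have hint : ∀ a : ℤ, (a : ℝ) ∈ (zInv ℓ).toSubring := fun a => intCast_mem _ a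
  have hinv : ((ℓ : ℝ))⁻¹ ∈ (zInv ℓ).toSubring := Algebra.subset_adjoin rfl
  refine factorial_pow_mul_coeff_mem (R := (zInv ℓ).toSubring) M' v' k (fun m => ?_)
    (V := V) (B := B) ?_ ?_ (b := (ℓ : ℚ) ^ n) ?_ ?_ hBc (F := F) ?_
  -- π_ℓ⁻¹ carries m ∈ ℤⁿ into (1/ℓ)ℤ ⊕ ℤ^{n-1}, and (π_ℓ v + m)M' = (v + π_ℓ⁻¹m)M; this is where
  -- the enlarged lattice in the hypothesis enters.
  · have h := hf (fun i => (m i : ℚ) / (if i = 0 then (ℓ : ℚ) else 1))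
      ⟨⟨m 0, by simp⟩, fun i hi => ⟨m i, by simp [hi]⟩⟩
    rw [hM', vecMul_toReal_piL_inv_mul ℓ M (x := fun i => ((v i + (m i : ℚ) /
      (if i = 0 then (ℓ : ℚ) else 1) : ℚ) : ℝ))]
    · exact h
    · intro i
      have : (ℓ : ℝ) ≠ 0 := Nat.cast_ne_zero.2 hℓ
      simp only [v']
      split_ifs
      · push_cast
        field_simp
      · simp
  · refine mem_integralLaurent M' v' k fun m => ?_
    obtain ⟨a, ha⟩ := hV m
    rw [← ha, Rat.cast_intCast]
    exact hint a
  · exact prod_mem fun i _ => sum_mem fun j _ => single_mem_integralLaurent M' v' k _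
      (by rw [Rat.cast_one]; exact one_mem _)
  · exact pow_ne_zero n (Nat.cast_ne_zero.2 hℓ)
  · rw [← inv_pow]
    push_cast
    exact pow_mem hinv n
  · rw [hFB, hM', vecMul_toReal_piL_inv_mul ℓ M (x := fun i => ((v i : ℚ) : ℝ))]
    intro i
    rfl

end Shintani

theorem theorem4p4 {n : ℕ} [NeZero n] (hn : 2 ≤ n) (ℓ : ℕ) [Fact ℓ.Prime]
    (A : Fin n → GL (Fin n) ℚ) (hA : ∀ i, A i ∈ Shintani.gammaL n ℓ)
    (M : Matrix (Fin n) (Fin n) ℝ) (hM : M ∈ Shintani.irrMat n)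
    (Q : Fin n → ℝ) (hQ : Q ∈ Shintani.irrVec n) (v : Fin n → ℚ)
    (hf : ∀ x ∈ Shintani.latticeL n ℓ,
      Shintani.normForm M (fun i => ((v i + x i : ℚ) : ℝ)) ∈ Shintani.zInv ℓ) :
    Shintani.psiShL ℓ A M Q v ∈ Shintani.hd n ∧
      ∀ k : ℕ, Shintani.shintaniOp k (Shintani.psiShL ℓ A M Q v) ∈ Shintani.zInv ℓ :=
  Shintani.psiShL_mem_hd_and_shintaniOp_mem ℓ hA hM Q v hf
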